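/- Let $Q\subset\mathbb R^3$ be a convex polytope containing the origin in its interior, let $(v_i)_{i\in I}$ be its vertices (labelled without repetition by a finite set $I$), and let $G$ be its 1-skeleton, so that $i$ and $j$ are adjacent in $G$ if and only if $v_i\neq v_j$ and the segment $v_iv_j$ is an edge of $Q$. Let $Q^*=\{p\in\mathbb R^3 : q^\top p\le 1 \text{ for all } q\in Q\}$ be the polar dual of $Q$; the edge of $Q^*$ dual to an edge $e$ of $Q$ is the set of all $p\in Q^*$ with $q^\top p=1$ for all $q\in e$. There is exactly one real matrix $M=(M_{ij})_{i,j\in I}$ (the Lovász matrix of $Q$) such that: - if $i$ and $j$ are adjacent, then $M_{ij}<0$ and $w_f-w_g=M_{ij}\,(v_i\times v_j)$, where $w_f\ne w_g$ are the endpoints, suitably labelled, of the edge of $Q^*$ dual to the edge $v_iv_j$; - if $i\neq j$ are not adjacent, then $M_{ij}=0$; - for every $i$, $\sum_{j} M_{ij}v_j=-M_{ii}v_i$, where the sum is over all $j$ adjacent to $i$. For $x\in\mathbb R^I$ let $P(x)=\{p\in\mathbb R^3 : v_i^\top p\le x_i \text{ for all } i\in I\}$. Then $P(1,\dots,1)=Q^*$,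 the first partial derivatives of $x\mapsto \mathrm{vol}(P(x))$ exist in a neighbourhood of $(1,\dots,1)$, and for all $i,j\in I$ the following second partial derivative exists and satisfies $$M_{ij}=-\left.\frac{\partial^2\,\mathrm{vol}(P(x))}{\partial x_i\,\partial x_j}\right|_{x=(1,\dots,1)}.$$ -/

import Mathlib

open Set Filter Topology MeasureTheory

noncomputable section

/-- Three-dimensional Euclidean space. -/
abbrev E3 : Type := EuclideanSpace ℝ (Fin 3)

/-- The cross product `a × b` of two vectors of Euclidean three-space. -/
def cross (a b : E3) : E3 := WithLp.toLp 2 (crossProduct a.ofLp b.ofLp)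

/-- A convex polytope: the convex hull of a finite set of points. -/
def IsConvexPolytope (Q : Set E3) : Prop := ∃ S : Set E3, S.Finite ∧ Q = convexHull ℝ S

/-- The polar dual `Q* = {p | q ⬝ p ≤ 1 for all q ∈ Q}`. -/
def polarDual (Q : Set E3) : Set E3 := {p | ∀ q ∈ Q, inner ℝ q p ≤ 1}

/-- The face of `Q*` dual to the face `F` of `Q`. For a facet `F` this is a single vertex
of `Q*`, for an edge `F` it is the dual edge, which joins the vertices of `Q*` dual to the two
facets of `Q` adjacent to `F`. -/
def dualFace (Q F : Set E3) : Set E3 := {p ∈ polarDual Q | ∀ q ∈ F, inner ℝ q p = 1}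

variable {ι : Type*}

/-- The 1-skeleton of `Q`, on a set of labels of the vertices `v i` of `Q`: `i` and `j` are
adjacent when the segment from `v i` to `v j` is a (nondegenerate) face of `Q`. -/
def skeleton (Q : Set E3) (v : ι → E3) : SimpleGraph ι where
  Adj i j := v i ≠ v j ∧ IsExposed ℝ Q (segment ℝ (v i) (v j))
  symm := ⟨fun i j h => ⟨h.1.symm, by rw [segment_symm]; exact h.2⟩⟩
  loopless := ⟨fun _ h => h.1 rfl⟩

open Classical in
/-- `M` is the matrix that the construction of Lovász associates with the polytope `Q`
with vertices `v i`. -/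
structure IsLovaszMatrix [Fintype ι] (Q : Set E3) (v : ι → E3) (M : Matrix ι ι ℝ) : Prop where
  /-- For an edge `v i v j` of `Q`, the dual edge of `Q*` has endpoints `w`, `w'`, labelled in
  such a way that `w - w' = M i j • (v i × v j)` with `M i j < 0`. -/
  edge : ∀ i j, (skeleton Q v).Adj i j → M i j < 0 ∧
    ∃ w w' : E3, w ≠ w' ∧ dualFace Q (segment ℝ (v i) (v j)) = segment ℝ w w' ∧
      w - w' = M i j • cross (v i) (v j)
  /-- The entries at distinct non-adjacent vertices vanish. -/
  nonadj : ∀ i j, i ≠ j → ¬ (skeleton Q v).Adj i j → M i j = 0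
  /-- The diagonal entries: the sum of `M i j • v j` over the neighbours `j` of `i` is
  `-(M i i) • v i`. -/
  diag : ∀ i, ∑ j with (skeleton Q v).Adj i j, M i j • v j = -(M i i) • v i

/-- The solution set `P(x) = {p | v i ⬝ p ≤ x i for all i}`. -/
def parPolytope (v : ι → E3) (x : ι → ℝ) : Set E3 := {p | ∀ i, inner ℝ (v i) p ≤ x i}

/-- `H` is the matrix of second partial derivatives of `f` at `x`: all first partial derivatives
of `f` exist near `x`, and the partial derivative with respect to the `j`-th coordinate has at `x`
the partial derivative `H i j` with respect to the `i`-th coordinate. -/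
def HasHessianMatrixAt [DecidableEq ι] [Fintype ι] (f : (ι → ℝ) → ℝ) (H : Matrix ι ι ℝ)
    (x : ι → ℝ) : Prop :=
  (∀ j, ∀ᶠ y in 𝓝 x, LineDifferentiableAt ℝ f y (Pi.single j (1 : ℝ))) ∧
  ∀ i j, HasLineDerivAt ℝ (fun y => lineDeriv ℝ f y (Pi.single j (1 : ℝ))) (H i j) x
    (Pi.single i (1 : ℝ))

end

/-! Fix vertices `v j`, `v k` with nonzero cross product and use the coordinates `(v j ⬝ p, v k ⬝ p,
(v j × v k) ⬝ p)`, which multiply volume by `‖v j × v k‖ ^ 2`. The `j`-th inequality becomes "first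
coordinate at most `x j`", so by Fubini the volume is an integral of slice areas up to `x j`, and
its derivative in `x j` is the scaled area of the facet slice (`facetVol`). The same argument inside
the facet shows that the derivative in `x k` is a scaled edge length (`edgeVol`). Both uses are
`hasLineDerivAt_polyVol_coordExt`. At `(1, …, 1)` the edge is the dual edge, and rescaling turns the
value into its Euclidean length divided by `‖v j × v k‖` (`edgeVol_eq_diam`). This is positive
exactly for adjacent vertices (`edgeVol_pos_iff`). If `v k` is parallel to `v j`, the `k`-th
inequality is slack on the facet of `j` and the mixed derivative is zero.

The fundamental theorem of calculus needs slice volumes to be continuous. They could jump only where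
an inequality degenerates to `0 ≤ 0`, which would put a vertex on the line through two others, or
put some `v j` on the segment from the origin to another vertex.

Diagonal entries come from translation: adding `(v m ⬝ q)` to `x` moves the polytope by `q`, so
every partial derivative of the volume is constant in that direction. Since the mixed partials are
continuous at `(1, …, 1)`, they determine the derivative of the `j`-th partial along every direction
with zero `j`-th coordinate. Correcting `e j` by a translation direction gives the diagonal second
derivative; translations with `v j ⬝ q = 0` give the vector identity defining the diagonal of the
Lovász matrix. -/

/-- If the partial derivatives of `f` along `e k`, `k ∈ S`, exist near `x` and are continuous
at `x`, then `f` has a line derivative at `x` along every combination of the `e k`. -/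
theorem hasLineDerivAt_sum_of_continuousAt {κ E : Type*} [NormedAddCommGroup E] [NormedSpace ℝ E]
    {f : E → ℝ} {B : κ → E → ℝ} {x : E} {e : κ → E} (S : Finset κ) (d : κ → ℝ)
    (hB : ∀ k ∈ S, ∀ᶠ y in 𝓝 x, HasLineDerivAt ℝ f (B k y) y (e k))
    (hc : ∀ k ∈ S, ContinuousAt (B k) x) :
    HasLineDerivAt ℝ f (∑ k ∈ S, d k * B k x) x (∑ k ∈ S, d k • e k) := by
  classical
  induction S using Finset.induction_on with
  | empty => simp [HasLineDerivAt, hasDerivAt_const]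
  | insert k S hk ih =>
    have ih := ih (fun m hm => hB m (Finset.mem_insert_of_mem hm))
      (fun m hm => hc m (Finset.mem_insert_of_mem hm))
    rw [Finset.sum_insert hk, Finset.sum_insert hk]
    set u := ∑ k ∈ S, d k • e k
    have hBk := hB k (Finset.mem_insert_self k S)
    have hck := hc k (Finset.mem_insert_self k S)
    have hmap : Tendsto (fun p : ℝ × ℝ => x + p.1 • u + p.2 • e k) (𝓝 (0, 0)) (𝓝 x) := by
      have : Continuous (fun p : ℝ × ℝ => x + p.1 • u + p.2 • e k) := by fun_prop
      simpa using this.tendsto (0, 0)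
    have hlin : Tendsto (fun t : ℝ => t * d k) (𝓝 0) (𝓝 0) := by
      have : Continuous (fun t : ℝ => t * d k) := by fun_prop
      simpa using this.tendsto 0
    -- The induction hypothesis controls the step from `x` to `x + t • u`. The remaining step along
    -- `e k` starts at a moving point; it is handled by the mean value inequality for `s ↦ f (x + t
    -- • u + s • e k) - s * B k x`, whose derivative is at most `ε` near the origin by continuity of
    -- `B k`.
    have key : (fun t : ℝ => f (x + t • u + (t * d k) • e k) - f (x + t • u) - t * d k * B k x)
        =o[𝓝 0] fun t : ℝ => t * d k := by
      rw [Asymptotics.isLittleO_iff]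
      intro ε hε
      have hev : ∀ᶠ p in 𝓝 ((0 : ℝ), (0 : ℝ)),
          HasLineDerivAt ℝ f (B k (x + p.1 • u + p.2 • e k)) (x + p.1 • u + p.2 • e k) (e k) ∧
          ‖B k (x + p.1 • u + p.2 • e k) - B k x‖ ≤ ε :=
        (hmap.eventually hBk).and (hmap.eventually (by
          filter_upwards [hck (Metric.closedBall_mem_nhds _ hε)] with y hy
          simpa [dist_eq_norm] using hy))
      obtain ⟨δ, hδ, hball⟩ := Metric.eventually_nhds_iff_ball.1 hev
      filter_upwards [Metric.ball_mem_nhds (0 : ℝ) hδ, hlin (Metric.ball_mem_nhds (0 : ℝ) hδ)]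
        with t ht ht'
      have hder : ∀ s ∈ Metric.ball (0 : ℝ) δ, HasDerivWithinAt
          (fun s : ℝ => f (x + t • u + s • e k) - s * B k x)
          (B k (x + t • u + s • e k) - B k x) (Metric.ball 0 δ) s := by
        intro s hs
        have hp := (hball (t, s) (by
          rw [Metric.mem_ball] at *
          simpa [Prod.dist_eq] using ⟨by simpa using ht, by simpa using hs⟩)).1
        have h1 : HasDerivAt (fun r : ℝ => f (x + t • u + s • e k + r • e k))
            (B k (x + t • u + s • e k)) (s - s) := by
          rw [sub_self]
          exact hp
        have h2 : HasDerivAt (fun s : ℝ => f (x + t • u + s • e k))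
            (B k (x + t • u + s • e k)) s := by
          refine (h1.comp_sub_const s s).congr_of_eventuallyEq (Eventually.of_forall fun r => ?_)
          show f _ = f _
          congr 1
          rw [sub_smul]
          abel
        exact (h2.sub (hasDerivAt_mul_const (B k x))).hasDerivWithinAt
      have := (convex_ball (0 : ℝ) δ).norm_image_sub_le_of_norm_hasDerivWithin_le hder
        (fun s hs => (hball (t, s) (by
          rw [Metric.mem_ball] at *
          simpa [Prod.dist_eq] using ⟨by simpa using ht, by simpa using hs⟩)).2)
        (Metric.mem_ball_self hδ) ht'
      refine (le_of_eq ?_).trans (this.trans_eq ?_)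
      · congr 1
        simp
        ring
      · simp
    have h3 : HasDerivAt (fun t : ℝ => f (x + t • u + (t * d k) • e k) - f (x + t • u))
        (d k * B k x) 0 := by
      rw [hasDerivAt_iff_isLittleO]
      have h4 : (fun t : ℝ => t * d k) =O[𝓝 0] (fun t : ℝ => t - 0) := by
        simpa [mul_comm] using
          Asymptotics.isBigO_const_mul_self (d k) (fun t : ℝ => t) (𝓝 0)
      refine (key.trans_isBigO h4).congr_left fun t => ?_
      simp [mul_assoc]
    have h5 := h3.add ih
    refine HasDerivAt.congr_of_eventuallyEq h5 (Eventually.of_forall fun t => ?_)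
    simp only [Pi.add_apply, sub_add_cancel]
    congr 1
    rw [smul_add, smul_smul]
    abel

/-! ### Volumes of polyhedra as functions of the right-hand sides -/

section PolyVol

variable {κ F : Type*} [NormedAddCommGroup F] [NormedSpace ℝ F]

/-- The solution set of the inequalities `b m p ≤ y m`, for `m ∈ S`. -/
def halfspaces (b : κ → F →L[ℝ] ℝ) (S : Finset κ) (y : κ → ℝ) : Set F :=
  {p | ∀ m ∈ S, b m p ≤ y m}

theorem isClosed_halfspaces (b : κ → F →L[ℝ] ℝ) (S : Finset κ) (y : κ → ℝ) :
    IsClosed (halfspaces b S y) := by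
  simp only [halfspaces, ofPred_forall]
  exact isClosed_biInter fun m _ => isClosed_le (b m).continuous continuous_const

/-- The volume of the solution set of the inequalities `b m p ≤ y m`, for `m ∈ S`. -/
def polyVol [MeasurableSpace F] (μ : Measure F) (b : κ → F →L[ℝ] ℝ) (S : Finset κ)
    (y : κ → ℝ) : ℝ := μ.real (halfspaces b S y)

/-- The functionals `(s, p) ↦ α m * s + b m p` on `ℝ × F`. -/
def coordExt (α : κ → ℝ) (b : κ → F →L[ℝ] ℝ) (m : κ) : ℝ × F →L[ℝ] ℝ :=
  α m • ContinuousLinearMap.fst ℝ ℝ F + (b m).comp (ContinuousLinearMap.snd ℝ ℝ F)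

@[simp]
theorem coordExt_apply (α : κ → ℝ) (b : κ → F →L[ℝ] ℝ) (m : κ) (p : ℝ × F) :
    coordExt α b m p = α m * p.1 + b m p.2 := by
  simp [coordExt]

/-- Slicing at a fixed first coordinate keeps the recession cone trivial: a recession direction `p`
of the slice gives the recession direction `(0, p)` of the whole. -/
theorem recession_erase [DecidableEq κ] {b : κ → F →L[ℝ] ℝ} {S : Finset κ} {α : κ → ℝ} {j : κ} (hbj : b j = 0)
    (hb : ∀ p, (∀ m ∈ S, coordExt α b m p ≤ 0) → p = 0) (p : F)
    (hp : ∀ m ∈ S.erase j, b m p ≤ 0) : p = 0 := by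
  have := hb (0, p) fun m hm => by
    rcases eq_or_ne m j with rfl | hmj
    · simp [hbj]
    · simpa using hp m (Finset.mem_erase.2 ⟨hmj, hm⟩)
  simpa using this

variable [FiniteDimensional ℝ F] {b : κ → F →L[ℝ] ℝ} {S : Finset κ}

/-- The homogeneous function `∑ max (b m p) 0` is positive on the compact unit sphere, hence at
least some `ε > 0` there, while on the polyhedron it is at most `∑ |y m|`. The constant does not
depend on `y`, which later supplies a common dominating ball. -/
theorem exists_halfspaces_subset_closedBall (hb : ∀ p, (∀ m ∈ S, b m p ≤ 0) → p = 0) :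
    ∃ C : ℝ, ∀ y, halfspaces b S y ⊆ Metric.closedBall 0 (C * ∑ m ∈ S, |y m|) := by
  let φ : F → ℝ := fun p => ∑ m ∈ S, max (b m p) 0
  have hφ : Continuous φ := by fun_prop
  have hpos : ∀ p ∈ Metric.sphere (0 : F) 1, 0 < φ p := by
    intro p hp
    have h0 : 0 ≤ φ p := Finset.sum_nonneg fun m _ => le_max_right _ _
    refine h0.lt_of_ne fun h => ?_
    have h1 := (Finset.sum_eq_zero_iff_of_nonneg (fun m _ => le_max_right (b m p) 0)).1 h.symm
    have : p = 0 := hb p fun m hm => by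
      have := h1 m hm
      exact this ▸ le_max_left _ _
    simp [this] at hp
  obtain ⟨ε, hε, hεφ⟩ : ∃ ε > 0, ∀ p ∈ Metric.sphere (0 : F) 1, ε ≤ φ p := by
    have : ProperSpace F := FiniteDimensional.proper ℝ F
    exact (isCompact_sphere (0 : F) 1).exists_forall_le' hφ.continuousOn hpos
  refine ⟨ε⁻¹, fun y p hp => ?_⟩
  rw [mem_closedBall_zero_iff]
  rcases eq_or_ne p 0 with rfl | hp0
  · simp only [norm_zero]
    positivity
  have hn : 0 < ‖p‖ := norm_pos_iff.2 hp0
  have h1 := hεφ (‖p‖⁻¹ • p) (by simp [norm_smul, hn.ne'])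
  have h2 : φ (‖p‖⁻¹ • p) = ‖p‖⁻¹ * φ p := by
    simp only [φ, Finset.mul_sum]
    refine Finset.sum_congr rfl fun m _ => ?_
    rw [map_smul, smul_eq_mul, mul_max_of_nonneg _ _ (by positivity), mul_zero]
  have h3 : φ p ≤ ∑ m ∈ S, |y m| := Finset.sum_le_sum fun m hm =>
    max_le ((hp m hm).trans (le_abs_self _)) (abs_nonneg _)
  rw [h2] at h1
  rw [inv_mul_eq_div, le_div_iff₀ hε]
  calc ‖p‖ * ε ≤ ‖p‖ * (‖p‖⁻¹ * φ p) := by gcongr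
    _ = φ p := by field_simp
    _ ≤ _ := h3

theorem measure_halfspaces_lt_top [MeasurableSpace F] (μ : Measure F)
    [IsFiniteMeasureOnCompacts μ] (hb : ∀ p, (∀ m ∈ S, b m p ≤ 0) → p = 0) (y : κ → ℝ) :
    μ (halfspaces b S y) < ⊤ := by
  have : ProperSpace F := FiniteDimensional.proper ℝ F
  obtain ⟨C, hC⟩ := exists_halfspaces_subset_closedBall hb
  exact (measure_mono (hC y)).trans_lt measure_closedBall_lt_top

variable [MeasurableSpace F] [BorelSpace F] (μ : Measure F) [μ.IsAddHaarMeasure]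

theorem measure_level_eq_zero (f : F →L[ℝ] ℝ) (c : ℝ) (h : f = 0 → c ≠ 0) :
    μ {p | f p = c} = 0 := by
  rcases eq_or_ne f 0 with h0 | h0
  · have : {p | f p = c} = ∅ := by
      ext p
      simp [h0, (h h0).symm]
    simp [this]
  · obtain ⟨q, hq⟩ : ∃ q, f q = c := by
      obtain ⟨q, hq⟩ := (f : F →ₗ[ℝ] ℝ).surjective (by exact_mod_cast h0) c
      exact ⟨q, hq⟩
    have h1 : {p | f p = c} = (fun p => (-q) + p) ⁻¹' (LinearMap.ker (f : F →ₗ[ℝ] ℝ) : Set F) := by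
      ext p
      simp only [mem_ofPred_eq, mem_preimage, SetLike.mem_coe, LinearMap.mem_ker,
        ContinuousLinearMap.coe_coe, map_add, map_neg, hq]
      constructor <;> intro h <;> linarith
    rw [h1, measure_preimage_add]
    refine Measure.addHaar_submodule μ _ fun h2 => h0 ?_
    ext p
    have : p ∈ LinearMap.ker (f : F →ₗ[ℝ] ℝ) := h2 ▸ Submodule.mem_top
    simpa using this

/-- Dominated convergence: off the finitely many level sets `b m p = y m`, the indicator is locally
constant in the right-hand side. The hypothesis on zero forms makes these sets null; otherwise `0 ≤
y m` could switch the whole set on or off. -/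
theorem continuousAt_polyVol [Finite κ] (hb : ∀ p, (∀ m ∈ S, b m p ≤ 0) → p = 0) {y : κ → ℝ}
    (hy : ∀ m ∈ S, b m = 0 → y m ≠ 0) : ContinuousAt (polyVol μ b S) y := by
  have : ProperSpace F := FiniteDimensional.proper ℝ F
  obtain ⟨C, hC⟩ := exists_halfspaces_subset_closedBall hb
  have hmeas : ∀ z, MeasurableSet (halfspaces b S z) := fun z =>
    (isClosed_halfspaces b S z).measurableSet
  have h1 : polyVol μ b S = fun z => ∫ p, (halfspaces b S z).indicator 1 p ∂μ := by
    ext z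
    rw [integral_indicator_one (hmeas z), polyVol]
  rw [h1]
  set R := C * ∑ m ∈ S, |y m| + 1
  have hR : ∀ᶠ z in 𝓝 y, C * ∑ m ∈ S, |z m| < R := by
    have : Continuous fun z : κ → ℝ => C * ∑ m ∈ S, |z m| := by fun_prop
    exact (this.tendsto y).eventually (gt_mem_nhds (by simp [R]))
  refine continuousAt_of_dominated (bound := (Metric.closedBall 0 R).indicator 1)
    (Eventually.of_forall fun z =>
      (aestronglyMeasurable_one.indicator (hmeas z))) ?_ ?_ ?_
  · filter_upwards [hR] with z hz
    refine Eventually.of_forall fun p => ?_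
    rw [norm_indicator_eq_indicator_norm]
    simp only [Pi.one_apply, norm_one]
    exact indicator_le_indicator_of_subset
      ((hC z).trans (Metric.closedBall_subset_closedBall hz.le)) (fun _ => zero_le_one) p
  · exact (integrable_indicator_iff measurableSet_closedBall).2
      (integrableOn_const measure_closedBall_lt_top.ne)
  · have h2 : ∀ᵐ p ∂μ, ∀ m ∈ S, b m p ≠ y m := by
      refine (ae_ball_iff S.countable_toSet).2 fun m hm => ?_
      rw [ae_iff]
      simpa using measure_level_eq_zero μ (b m) (y m) (hy m hm)
    filter_upwards [h2] with p hp
    have h3 : ∀ᶠ z in 𝓝 y, ∀ m ∈ S, (b m p ≤ z m ↔ b m p ≤ y m) := by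
      rw [S.eventually_all]
      intro m hm
      have hcm : Tendsto (fun z : κ → ℝ => z m) (𝓝 y) (𝓝 (y m)) := (continuous_apply m).tendsto y
      rcases (hp m hm).lt_or_gt with h | h
      · filter_upwards [hcm.eventually (lt_mem_nhds h)] with z hz
        exact ⟨fun _ => h.le, fun _ => hz.le⟩
      · filter_upwards [hcm.eventually (gt_mem_nhds h)] with z hz
        exact ⟨fun h' => absurd h' hz.not_ge, fun h' => absurd h' h.not_ge⟩
    refine ContinuousAt.congr (f := fun _ => (halfspaces b S y).indicator (1 : F → ℝ) p)
      continuousAt_const ?_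
    filter_upwards [h3] with z hz
    have h4 : p ∈ halfspaces b S z ↔ p ∈ halfspaces b S y :=
      forall₂_congr hz
    by_cases h5 : p ∈ halfspaces b S y
    · rw [indicator_of_mem h5, indicator_of_mem (h4.2 h5)]
    · rw [indicator_of_notMem h5, indicator_of_notMem (h4.not.2 h5)]

variable [DecidableEq κ]

/-- Fubini in the first coordinate, on which the `j`-th inequality is just the bound `s ≤ t`. -/
theorem polyVol_coordExt_update {α : κ → ℝ} {j : κ} (hjS : j ∈ S) (hαj : α j = 1) (hbj : b j = 0)
    (hb : ∀ p, (∀ m ∈ S, coordExt α b m p ≤ 0) → p = 0) (x : κ → ℝ) (t : ℝ) :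
    IntegrableOn (fun s => polyVol μ b (S.erase j) fun m => x m - s * α m) (Iic t) ∧
    polyVol (volume.prod μ) (coordExt α b) S (Function.update x j t) =
      ∫ s in Iic t, polyVol μ b (S.erase j) fun m => x m - s * α m := by
  have hmeas : MeasurableSet (halfspaces (coordExt α b) S (Function.update x j t)) :=
    (isClosed_halfspaces _ _ _).measurableSet
  have hfin := (measure_halfspaces_lt_top ((volume : Measure ℝ).prod μ) hb
    (Function.update x j t)).ne
  have hslice : (fun s => μ.real (Prod.mk s ⁻¹'
      halfspaces (coordExt α b) S (Function.update x j t))) =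
      (Iic t).indicator fun s => polyVol μ b (S.erase j) fun m => x m - s * α m := by
    ext s
    by_cases hs : s ≤ t
    · rw [indicator_of_mem (by exact hs), polyVol]
      congr 1
      ext p
      simp only [halfspaces, mem_preimage, mem_ofPred_eq, coordExt_apply]
      constructor
      · intro h m hm
        have := h m (Finset.mem_of_mem_erase hm)
        rw [Function.update_of_ne (Finset.ne_of_mem_erase hm)] at this
        linarith
      · intro h m hm
        rcases eq_or_ne m j with rfl | hmj
        · simpa [hbj, hαj] using hs
        · have := h m (Finset.mem_erase.2 ⟨hmj, hm⟩)
          rw [Function.update_of_ne hmj]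
          linarith
    · rw [indicator_of_notMem (by exact hs)]
      have : Prod.mk s ⁻¹' halfspaces (coordExt α b) S (Function.update x j t) = ∅ := by
        ext p
        simp only [halfspaces, mem_preimage, mem_ofPred_eq, coordExt_apply, mem_empty_iff_false,
          iff_false]
        intro h
        have := h j hjS
        simp [hbj, hαj] at this
        exact hs this
      simp [this]
  have hint := Measure.integrable_measure_prodMk_left hmeas hfin
  rw [hslice, integrable_indicator_iff measurableSet_Iic] at hint
  refine ⟨hint, ?_⟩
  rw [← integral_indicator measurableSet_Iic, ← hslice, polyVol, measureReal_def,
    Measure.prod_apply hmeas]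
  simp only [measureReal_def]
  rw [integral_toReal (measurable_measure_prodMk_left hmeas).aemeasurable
    (Measure.ae_measure_lt_top hmeas hfin)]

/-- The fundamental theorem of calculus for the Fubini integral; `hx` gives continuity of the slice
volume at the endpoint `x j`. -/
theorem hasLineDerivAt_polyVol_coordExt [Finite κ] {α : κ → ℝ} {j : κ} (hjS : j ∈ S) (hαj : α j = 1)
    (hbj : b j = 0) (hb : ∀ p, (∀ m ∈ S, coordExt α b m p ≤ 0) → p = 0) {x : κ → ℝ}
    (hx : ∀ m ∈ S.erase j, b m = 0 → x m - x j * α m ≠ 0) :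
    HasLineDerivAt ℝ (polyVol (volume.prod μ) (coordExt α b) S)
      (polyVol μ b (S.erase j) fun m => x m - x j * α m) x (Pi.single j 1) := by
  set g : ℝ → ℝ := fun s => polyVol μ b (S.erase j) fun m => x m - s * α m
  have hg := polyVol_coordExt_update μ hjS hαj hbj hb x
  have hcont : ContinuousAt g (x j) := by
    have h1 : Continuous fun s : ℝ => fun m => x m - s * α m := by fun_prop
    exact (continuousAt_polyVol μ (recession_erase hbj hb) hx).comp_of_eq h1.continuousAt rfl
  have hgi : IntervalIntegrable g volume (x j - 1) (x j) :=
    (intervalIntegrable_iff_integrableOn_Ioc_of_le (by linarith)).2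
      ((hg (x j)).1.mono_set Ioc_subset_Iic_self)
  have hgm : StronglyMeasurableAtFilter g (𝓝 (x j)) :=
    ⟨Iic (x j + 1), Iic_mem_nhds (by linarith), (hg (x j + 1)).1.aestronglyMeasurable⟩
  have h2 := (intervalIntegral.integral_hasDerivAt_right hgi hgm hcont).const_add
    (∫ s in Iic (x j - 1), g s)
  have h3 : HasDerivAt (fun t => polyVol (volume.prod μ) (coordExt α b) S
      (Function.update x j t)) (g (x j)) (x j) := by
    refine h2.congr_of_eventuallyEq (Eventually.of_forall fun t => ?_)
    show polyVol _ _ _ _ = _ + _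
    rw [(hg t).2, ← intervalIntegral.integral_Iic_sub_Iic (hg _).1 (hg _).1]
    ring
  have h4 : HasDerivAt (fun t => polyVol (volume.prod μ) (coordExt α b) S
      (Function.update x j (x j + t))) (g (x j)) 0 :=
    HasDerivAt.comp_const_add (x j) 0 (by simpa using h3)
  refine h4.congr_of_eventuallyEq (Eventually.of_forall fun t => ?_)
  show polyVol _ _ _ _ = polyVol _ _ _ _
  congr 1
  ext m
  rcases eq_or_ne m j with rfl | hmj
  · simp
  · simp [hmj]

end PolyVol

/-! ### Cross products and coordinates adapted to a pair of vectors -/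

section Cross

theorem inner_eq_sum (a b : E3) : inner ℝ a b = a 0 * b 0 + a 1 * b 1 + a 2 * b 2 := by
  simp [PiLp.inner_apply, Fin.sum_univ_three, mul_comm]

@[simp]
theorem cross_zero_coord (a b : E3) : cross a b 0 = a 1 * b 2 - a 2 * b 1 := by
  simp [cross, crossProduct]

@[simp]
theorem cross_one_coord (a b : E3) : cross a b 1 = a 2 * b 0 - a 0 * b 2 := by
  simp [cross, crossProduct]

@[simp]
theorem cross_two_coord (a b : E3) : cross a b 2 = a 0 * b 1 - a 1 * b 0 := by
  simp [cross, crossProduct]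

theorem E3.ext {a b : E3} (h0 : a 0 = b 0) (h1 : a 1 = b 1) (h2 : a 2 = b 2) : a = b := by
  ext i
  fin_cases i <;> assumption

theorem cross_swap (a b : E3) : cross b a = -cross a b := by
  apply E3.ext <;> simp <;> ring

/-- The basis dual to `(a, b, a × b)`: first vector. -/
noncomputable def dualFst (a b : E3) : E3 := (‖cross a b‖ ^ 2)⁻¹ • cross b (cross a b)

/-- The basis dual to `(a, b, a × b)`: second vector. -/
noncomputable def dualSnd (a b : E3) : E3 := (‖cross a b‖ ^ 2)⁻¹ • cross (cross a b) a

/-- The basis dual to `(a, b, a × b)`: third vector. -/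
noncomputable def dualTrd (a b : E3) : E3 := (‖cross a b‖ ^ 2)⁻¹ • cross a b

theorem norm_cross_sq (a b : E3) : ‖cross a b‖ ^ 2 =
    (a 1 * b 2 - a 2 * b 1) ^ 2 + (a 2 * b 0 - a 0 * b 2) ^ 2 + (a 0 * b 1 - a 1 * b 0) ^ 2 := by
  rw [← real_inner_self_eq_norm_sq, inner_eq_sum]
  simp
  ring

variable {a b : E3}

theorem dual_expansion (h : cross a b ≠ 0) (p : E3) :
    p = inner ℝ a p • dualFst a b + inner ℝ b p • dualSnd a b +
      inner ℝ (cross a b) p • dualTrd a b := by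
  have hN : ‖cross a b‖ ^ 2 ≠ 0 := by simpa using h
  simp only [dualFst, dualSnd, dualTrd]
  rw [smul_comm (inner ℝ a p), smul_comm (inner ℝ b p), smul_comm (inner ℝ (cross a b) p),
    ← smul_add, ← smul_add, eq_inv_smul_iff₀ hN, norm_cross_sq]
  simp only [inner_eq_sum]
  apply E3.ext <;> simp <;> ring

theorem primal_expansion (h : cross a b ≠ 0) (p : E3) :
    p = inner ℝ p (dualFst a b) • a + inner ℝ p (dualSnd a b) • b +
      inner ℝ p (dualTrd a b) • cross a b := by
  have hN : ‖cross a b‖ ^ 2 ≠ 0 := by simpa using h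
  simp only [dualFst, dualSnd, dualTrd, inner_smul_right, mul_smul]
  rw [← smul_add, ← smul_add, eq_inv_smul_iff₀ hN, norm_cross_sq]
  simp only [inner_eq_sum]
  apply E3.ext <;> simp <;> ring

theorem inner_expansion (h : cross a b ≠ 0) (q p : E3) :
    inner ℝ q p = inner ℝ q (dualFst a b) * inner ℝ a p + (inner ℝ q (dualSnd a b) * inner ℝ b p +
      inner ℝ q (dualTrd a b) * inner ℝ (cross a b) p) := by
  conv_lhs => rw [dual_expansion h p]
  simp only [inner_add_right, inner_smul_right]
  ring

theorem inner_left_dualFst (h : cross a b ≠ 0) : inner ℝ a (dualFst a b) = 1 := by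
  have hN : ‖cross a b‖ ^ 2 ≠ 0 := by simpa using h
  rw [dualFst, inner_smul_right, inv_mul_eq_one₀ hN, norm_cross_sq, inner_eq_sum]
  simp
  ring

theorem inner_right_dualSnd (h : cross a b ≠ 0) : inner ℝ b (dualSnd a b) = 1 := by
  have hN : ‖cross a b‖ ^ 2 ≠ 0 := by simpa using h
  rw [dualSnd, inner_smul_right, inv_mul_eq_one₀ hN, norm_cross_sq, inner_eq_sum]
  simp
  ring

theorem inner_cross_dualTrd (h : cross a b ≠ 0) : inner ℝ (cross a b) (dualTrd a b) = 1 := by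
  have hN : ‖cross a b‖ ^ 2 ≠ 0 := by simpa using h
  rw [dualTrd, inner_smul_right, real_inner_self_eq_norm_sq, inv_mul_cancel₀ hN]

theorem inner_right_dualFst : inner ℝ b (dualFst a b) = 0 := by
  rw [dualFst, inner_smul_right, inner_eq_sum]
  simp
  right
  ring

theorem inner_left_dualSnd : inner ℝ a (dualSnd a b) = 0 := by
  rw [dualSnd, inner_smul_right, inner_eq_sum]
  simp
  right
  ring

theorem inner_left_dualTrd : inner ℝ a (dualTrd a b) = 0 := by
  rw [dualTrd, inner_smul_right, inner_eq_sum]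
  simp
  right
  ring

theorem inner_right_dualTrd : inner ℝ b (dualTrd a b) = 0 := by
  rw [dualTrd, inner_smul_right, inner_eq_sum]
  simp
  right
  ring

theorem exists_eq_smul_of_cross_eq_zero (ha : a ≠ 0) (h : cross a b = 0) : ∃ c : ℝ, b = c • a := by
  have hN : ‖a‖ ^ 2 ≠ 0 := by simpa using ha
  refine ⟨(‖a‖ ^ 2)⁻¹ * inner ℝ a b, ?_⟩
  rw [mul_smul, eq_inv_smul_iff₀ hN, ← real_inner_self_eq_norm_sq]
  have h1 : inner ℝ a a • b - inner ℝ a b • a = cross (cross a b) a := by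
    simp only [inner_eq_sum]
    apply E3.ext <;> simp <;> ring
  have h2 : cross (0 : E3) a = 0 := by apply E3.ext <;> simp
  rwa [h, h2, sub_eq_zero] at h1

/-- The coordinates `(a ⬝ p, b ⬝ p, (a × b) ⬝ p)` of a point `p`. -/
noncomputable def pairCoords (a b p : E3) : ℝ × ℝ × ℝ :=
  (inner ℝ a p, inner ℝ b p, inner ℝ (cross a b) p)

theorem continuous_pairCoords (a b : E3) : Continuous (pairCoords a b) := by
  unfold pairCoords
  fun_prop

/-- The matrix with rows `a`, `b`, `a × b` has determinant `‖a × b‖ ^ 2`. -/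
theorem map_pairCoords (h : cross a b ≠ 0) :
    Measure.map (pairCoords a b) volume = ENNReal.ofReal (‖cross a b‖ ^ 2)⁻¹ • volume := by
  have hN : ‖cross a b‖ ^ 2 ≠ 0 := by simpa using h
  let A : Matrix (Fin 3) (Fin 3) ℝ := Matrix.of ![a.ofLp, b.ofLp, (cross a b).ofLp]
  have hdet : A.det = ‖cross a b‖ ^ 2 := by
    rw [norm_cross_sq, Matrix.det_fin_three]
    simp [A]
    ring
  have h1 := PiLp.volume_preserving_ofLp (Fin 3)
  have h2 := Real.map_matrix_volume_pi_eq_smul_volume_pi (hdet ▸ hN)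
  have h3 := volume_preserving_piFinSuccAbove (fun _ : Fin 3 => ℝ) 0
  have h4 := (MeasurePreserving.id (volume : Measure ℝ)).prod (volume_preserving_finTwoArrow ℝ)
  have h5 := h4.comp h3
  set e := Prod.map id (MeasurableEquiv.finTwoArrow (α := ℝ)) ∘
    MeasurableEquiv.piFinSuccAbove (fun _ : Fin 3 => ℝ) 0
  have h6 : pairCoords a b = e ∘ Matrix.toLin' A ∘ WithLp.ofLp := by
    ext p
    · simp [e, pairCoords, A, dotProduct, Fin.sum_univ_three, inner_eq_sum]
    · simp [e, pairCoords, A, dotProduct, Fin.sum_univ_three, inner_eq_sum]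
    · simp [e, pairCoords, A, dotProduct, Fin.sum_univ_three, inner_eq_sum]
  have hA : Measurable (Matrix.toLin' A) :=
    (LinearMap.continuous_of_finiteDimensional _).measurable
  rw [h6, ← Measure.map_map h5.measurable (hA.comp h1.measurable),
    ← Measure.map_map hA h1.measurable, h1.map_eq, h2, Measure.map_smul, h5.map_eq, hdet,
    abs_of_nonneg (by positivity)]
  rfl

end Cross

/-! ### Vertices, edges and the polar dual -/

section Polytope

variable {ι : Type*} {Q : Set E3} {v : ι → E3}

/-- Krein–Milman; the closure is superfluous because the hull of finitely many points is compact. -/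
theorem IsConvexPolytope.eq_convexHull_range [Finite ι] (hQ : IsConvexPolytope Q)
    (hvQ : range v = Q.extremePoints ℝ) : Q = convexHull ℝ (range v) := by
  obtain ⟨S, hS, rfl⟩ := hQ
  have hS' : IsCompact (convexHull ℝ S) := hS.isCompact_convexHull ℝ
  have hv : IsCompact (convexHull ℝ (range v)) := (finite_range v).isCompact_convexHull ℝ
  have h := closure_convexHull_extremePoints hS' (convex_convexHull ℝ S)
  rw [← hvQ, hv.isClosed.closure_eq] at h
  exact h.symm

theorem convexHull_range_le (l : E3 → ℝ) (hl : IsLinearMap ℝ l) {c : ℝ} (h : ∀ m, l (v m) ≤ c) :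
    ∀ q ∈ convexHull ℝ (range v), l q ≤ c :=
  fun _ hq => convexHull_min (t := {q | l q ≤ c}) (by rintro _ ⟨m, rfl⟩; exact h m)
    (convex_halfSpace_le hl c) hq

theorem isLinearMap_inner_left (p : E3) : IsLinearMap ℝ fun q : E3 => inner ℝ q p :=
  ⟨fun _ _ => inner_add_left _ _ _, fun _ _ => by simp [real_inner_smul_left]⟩

theorem polarDual_convexHull_range (hQ : Q = convexHull ℝ (range v)) :
    polarDual Q = {p | ∀ m, inner ℝ (v m) p ≤ 1} := by
  subst hQ
  ext p
  exact ⟨fun h m => h _ (subset_convexHull ℝ _ ⟨m, rfl⟩),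
    fun h => convexHull_range_le _ (isLinearMap_inner_left p) h⟩

/-- The inequality extends to all of `Q`, which contains `t • p` for some `t > 0`, so `t * ‖p‖ ^ 2 ≤
0`. -/
theorem eq_zero_of_forall_inner_le_zero (hQ : Q = convexHull ℝ (range v))
    (h0 : (0 : E3) ∈ interior Q) (p : E3) (hp : ∀ m, inner ℝ (v m) p ≤ 0) : p = 0 := by
  have h1 : Tendsto (fun t : ℝ => t • p) (𝓝[>] 0) (𝓝 0) := by
    have : Continuous fun t : ℝ => t • p := by fun_prop
    simpa using (this.tendsto 0).mono_left nhdsWithin_le_nhds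
  obtain ⟨t, ht, htQ⟩ := ((eventually_mem_nhdsWithin (a := (0 : ℝ)) (s := Ioi 0)).and
    (h1.eventually (mem_interior_iff_mem_nhds.1 h0))).exists
  have h2 := convexHull_range_le _ (isLinearMap_inner_left p) hp (t • p) (hQ ▸ htQ)
  rw [real_inner_smul_left] at h2
  have ht' : (0 : ℝ) < t := ht
  have h3 : inner ℝ p p ≤ 0 := by
    by_contra! h
    exact absurd h2 (mul_pos ht' h).not_ge
  exact inner_self_eq_zero.1 (h3.antisymm real_inner_self_nonneg)

theorem vertex_mem (hvQ : range v = Q.extremePoints ℝ) (m : ι) : v m ∈ Q :=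
  extremePoints_subset (hvQ ▸ mem_range_self m)

theorem eq_or_eq_of_mem_segment (hvQ : range v = Q.extremePoints ℝ)
    {m : ι} {x y : E3} (hx : x ∈ Q) (hy : y ∈ Q) (h : v m ∈ segment ℝ x y) :
    x = v m ∨ y = v m :=
  (mem_extremePoints_iff_forall_segment.1 (hvQ ▸ mem_range_self m)).2 x hx y hy h

theorem not_mem_segment_vertices (hv : Function.Injective v) (hvQ : range v = Q.extremePoints ℝ)
    {j k m : ι} (hj : m ≠ j) (hk : m ≠ k) : v m ∉ segment ℝ (v j) (v k) := fun h =>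
  (eq_or_eq_of_mem_segment hvQ (vertex_mem hvQ j) (vertex_mem hvQ k) h).elim
    (fun h => hj (hv h.symm)) fun h => hk (hv h.symm)

theorem vertex_ne_zero (hvQ : range v = Q.extremePoints ℝ)
    (h0 : (0 : E3) ∈ interior Q) (j : ι) : v j ≠ 0 := by
  intro hj
  obtain ⟨ε, hε, hball⟩ := Metric.mem_nhds_iff.1 (mem_interior_iff_mem_nhds.1 h0)
  have hmem : ∀ s : ℝ, |s| < ε → EuclideanSpace.single (0 : Fin 3) s ∈ Q := fun s hs =>
    hball (by simpa using hs)
  have hext := mem_extremePoints_iff_forall_segment.1 (hvQ ▸ mem_range_self (f := v) j)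
  have h1 : |ε / 2| < ε := by rw [abs_of_pos (by positivity)]; linarith
  have := hext.2 _ (hmem (ε / 2) h1) _ (hmem (-(ε / 2)) (by rwa [abs_neg]))
    (by
      rw [hj]
      refine ⟨1 / 2, 1 / 2, by norm_num, by norm_num, by norm_num, ?_⟩
      ext i
      simp only [one_div, PiLp.add_apply, PiLp.smul_apply, PiLp.single_apply]
      split_ifs <;> simp)
  rw [hj] at this
  rcases this with h | h <;> simp at h <;> linarith

/-- If `c ≥ 1`, the extreme point `v j` would lie on the segment from `0` to `v m`. -/
theorem lt_one_of_vertex_eq_smul (hv : Function.Injective v) (hvQ : range v = Q.extremePoints ℝ)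
    (h0 : (0 : E3) ∈ interior Q) {j m : ι} (hmj : m ≠ j) {c : ℝ} (h : v m = c • v j) : c < 1 := by
  by_contra! hc
  have hc0 : c ≠ 0 := by linarith
  have h1 : v j ∈ segment ℝ 0 (v m) := by
    refine ⟨1 - c⁻¹, c⁻¹, by simpa using inv_le_one_of_one_le₀ hc, by positivity, by ring, ?_⟩
    rw [h, smul_zero, zero_add, smul_smul, inv_mul_cancel₀ hc0, one_smul]
  rcases eq_or_eq_of_mem_segment hvQ (interior_subset h0) (vertex_mem hvQ m) h1 with h2 | h2
  · rw [← h2, smul_zero] at h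
    exact hmj (hv (h.trans h2))
  · exact hmj (hv h2)

/-- If `s + t = 1`, the three vertices are collinear, and the signs of `s` and `t` tell which one
lies between the other two. -/
theorem add_ne_one_of_vertex_eq (hv : Function.Injective v) (hvQ : range v = Q.extremePoints ℝ)
    {j k m : ι} (hjk : j ≠ k) (hmj : m ≠ j) (hmk : m ≠ k) {s t : ℝ}
    (h : v m = s • v j + t • v k) : s + t ≠ 1 := by
  intro hst
  by_cases hs : 0 ≤ s
  · by_cases ht : 0 ≤ t
    · exact not_mem_segment_vertices hv hvQ hmj hmk ⟨s, t, hs, ht, hst, h.symm⟩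
    · push Not at ht
      have hs0 : s ≠ 0 := by linarith
      have hs1 : 0 < s := by positivity
      refine not_mem_segment_vertices hv hvQ hmj.symm hjk
        ⟨s⁻¹, -t * s⁻¹, by positivity, mul_nonneg (by linarith) (by positivity), ?_, ?_⟩
      · field_simp
        linarith
      · rw [h, smul_add, smul_smul, smul_smul, inv_mul_cancel₀ hs0, one_smul, add_assoc,
          ← add_smul]
        convert add_zero (v j)
        convert zero_smul ℝ (v k)
        ring
  · push Not at hs
    have ht0 : t ≠ 0 := by linarith
    have ht1 : 0 < t := by linarith
    refine not_mem_segment_vertices hv hvQ hmk.symm hjk.symm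
      ⟨t⁻¹, -s * t⁻¹, by positivity, mul_nonneg (by linarith) (by positivity), ?_, ?_⟩
    · field_simp
      linarith
    · rw [h, smul_add, smul_smul, smul_smul, inv_mul_cancel₀ ht0, one_smul, add_right_comm,
        ← add_smul]
      convert zero_add (v k)
      convert zero_smul ℝ (v j)
      ring

/-- If every `v m` were parallel to `v j`, each `v j × w` would be orthogonal to all vertices and
hence zero, forcing `v j = 0`. -/
theorem exists_cross_ne_zero (hvQ : range v = Q.extremePoints ℝ) (hQ : Q = convexHull ℝ (range v))
    (h0 : (0 : E3) ∈ interior Q) (j : ι) : ∃ k, cross (v j) (v k) ≠ 0 := by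
  by_contra! h
  have h1 : ∀ w, cross (v j) w = 0 := fun w => by
    refine eq_zero_of_forall_inner_le_zero hQ h0 _ fun m => ?_
    have : inner ℝ (v m) (cross (v j) w) = - inner ℝ w (cross (v j) (v m)) := by
      simp only [inner_eq_sum, cross_zero_coord, cross_one_coord, cross_two_coord]
      ring
    rw [this, h m]
    simp
  refine vertex_ne_zero hvQ h0 j ?_
  have h2 := h1 (EuclideanSpace.single 0 1)
  have h3 := h1 (EuclideanSpace.single 1 1)
  apply E3.ext
  · simpa using congrArg (fun p : E3 => p 2) h3
  · simpa using congrArg (fun p : E3 => p 2) h2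
  · simpa using congrArg (fun p : E3 => p 1) h2

theorem inner_eq_of_mem_segment {x y q p : E3} {c : ℝ} (hx : inner ℝ x p = c)
    (hy : inner ℝ y p = c) (hq : q ∈ segment ℝ x y) : inner ℝ q p = c := by
  obtain ⟨s, t, -, -, hst, rfl⟩ := hq
  rw [inner_add_left, real_inner_smul_left, real_inner_smul_left, hx, hy, ← add_mul, hst, one_mul]

theorem exists_of_adj (hv : Function.Injective v) (hvQ : range v = Q.extremePoints ℝ)
    (hQ : Q = convexHull ℝ (range v)) (h0 : (0 : E3) ∈ interior Q) {j k : ι}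
    (h : (skeleton Q v).Adj j k) : ∃ p : E3, inner ℝ (v j) p = 1 ∧ inner ℝ (v k) p = 1 ∧
      ∀ m, m ≠ j → m ≠ k → inner ℝ (v m) p < 1 := by
  have hjk : j ≠ k := fun h' => h.1 (h' ▸ rfl)
  obtain ⟨l, hl⟩ := h.2 ⟨_, left_mem_segment ℝ _ _⟩
  obtain ⟨p, rfl⟩ := (InnerProductSpace.toDual ℝ E3).surjective l
  simp only [InnerProductSpace.toDual_apply_apply, real_inner_comm _ p] at hl
  have hj : ∀ q ∈ Q, inner ℝ q p ≤ inner ℝ (v j) p :=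
    (hl ▸ left_mem_segment ℝ (v j) (v k) : v j ∈ {x ∈ Q | ∀ y ∈ Q, inner ℝ y p ≤ inner ℝ x p}).2
  have hk : ∀ q ∈ Q, inner ℝ q p ≤ inner ℝ (v k) p :=
    (hl ▸ right_mem_segment ℝ (v j) (v k) : v k ∈ {x ∈ Q | ∀ y ∈ Q, inner ℝ y p ≤ inner ℝ x p}).2
  have hjk' : inner ℝ (v k) p = inner ℝ (v j) p :=
    le_antisymm (hj _ (vertex_mem hvQ k)) (hk _ (vertex_mem hvQ j))
  have hlt : ∀ m, m ≠ j → m ≠ k → inner ℝ (v m) p < inner ℝ (v j) p := by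
    intro m hmj hmk
    refine (hj _ (vertex_mem hvQ m)).lt_of_ne fun he => ?_
    refine not_mem_segment_vertices hv hvQ hmj hmk ?_
    rw [hl]
    exact ⟨vertex_mem hvQ m, fun q hq => he ▸ hj q hq⟩
  -- The maximum of the exposing functional is nonnegative since `0 ∈ Q`. If it vanished, the
  -- functional would be zero, `j` and `k` would be the only vertices, and `Q` could not have
  -- interior. Positivity allows rescaling the maximum to `1`.
  have hpos : 0 < inner ℝ (v j) p := by
    have h1 : 0 ≤ inner ℝ (v j) p := by simpa using hj 0 (interior_subset h0)
    refine h1.lt_of_ne fun h2 => ?_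
    have hp0 : p = 0 := eq_zero_of_forall_inner_le_zero hQ h0 p fun m =>
      (hj _ (vertex_mem hvQ m)).trans h2.ge
    have hall : ∀ m, m = j ∨ m = k := by
      intro m
      by_contra! hm
      have := hlt m hm.1 hm.2
      simp [hp0] at this
    obtain ⟨k', hk'⟩ := exists_cross_ne_zero hvQ hQ h0 j
    have hself : cross (v j) (v j) = 0 := by apply E3.ext <;> simp <;> ring
    rcases hall k' with rfl | rfl
    · exact hk' hself
    · refine hk' (eq_zero_of_forall_inner_le_zero hQ h0 _ fun m => ?_)
      rcases hall m with rfl | rfl <;> refine le_of_eq ?_ <;> rw [inner_eq_sum] <;> simp <;> ring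
  set c : ℝ := inner ℝ (v j) p
  refine ⟨c⁻¹ • p, ?_, ?_, fun m hmj hmk => ?_⟩
  · rw [inner_smul_right, inv_mul_cancel₀ hpos.ne']
  · rw [inner_smul_right, hjk', inv_mul_cancel₀ hpos.ne']
  · rw [inner_smul_right, inv_mul_lt_one₀ hpos]
    exact hlt m hmj hmk

theorem exists_weights [Fintype ι] {x : E3} (hx : x ∈ convexHull ℝ (range v)) :
    ∃ w : ι → ℝ, (∀ m, 0 ≤ w m) ∧ ∑ m, w m = 1 ∧ ∑ m, w m • v m = x := by
  classical
  have h := (convexHull_basis_eq_stdSimplex (R := ℝ) (ι := ι))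
  have h2 : range v = (Fintype.linearCombination ℝ v) '' range (fun i j : ι => if i = j then 1 else 0) := by
    rw [← range_comp]
    congr 1
    ext m : 1
    simp [Fintype.linearCombination_apply]
  rw [h2, ← LinearMap.image_convexHull, h] at hx
  obtain ⟨w, hw, rfl⟩ := hx
  exact ⟨w, hw.1, hw.2, rfl⟩

/-- In a convex combination of vertices attaining the maximum `1`, every vertex with a smaller value
has weight zero. -/
theorem adj_of_inner_lt [Fintype ι] (hv : Function.Injective v)
    (hvQ : range v = Q.extremePoints ℝ)
    (hQ : Q = convexHull ℝ (range v)) {j k : ι} (hjk : j ≠ k) {p : E3} (hj : inner ℝ (v j) p = 1)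
    (hk : inner ℝ (v k) p = 1) (hlt : ∀ m, m ≠ j → m ≠ k → inner ℝ (v m) p < 1) :
    (skeleton Q v).Adj j k := by
  classical
  refine ⟨hv.ne hjk, fun _ => ⟨InnerProductSpace.toDual ℝ E3 p, ?_⟩⟩
  simp only [InnerProductSpace.toDual_apply_apply, real_inner_comm _ p]
  have hle : ∀ m, inner ℝ (v m) p ≤ 1 := fun m => by
    by_cases hmj : m = j
    · rw [hmj, hj]
    by_cases hmk : m = k
    · rw [hmk, hk]
    exact (hlt m hmj hmk).le
  have hleQ : ∀ q ∈ Q, inner ℝ q p ≤ 1 := by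
    rw [hQ]
    exact convexHull_range_le _ (isLinearMap_inner_left p) hle
  have hconv : Convex ℝ Q := hQ ▸ convex_convexHull ℝ _
  refine Subset.antisymm (fun x hx => ⟨hconv.segment_subset (vertex_mem hvQ j)
    (vertex_mem hvQ k) hx, fun q hq => ?_⟩) ?_
  · rw [inner_eq_of_mem_segment hj hk hx]
    exact hleQ q hq
  · rintro x ⟨hxQ, hx⟩
    have hx1 : 1 ≤ inner ℝ x p := hj ▸ hx _ (vertex_mem hvQ j)
    obtain ⟨w, hw0, hw1, rfl⟩ := exists_weights (hQ ▸ hxQ)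
    have h1 : ∑ m, w m * (1 - inner ℝ (v m) p) ≤ 0 := by
      simp only [mul_sub, mul_one, Finset.sum_sub_distrib, hw1]
      simp only [sum_inner, real_inner_smul_left] at hx1
      linarith
    have hnn : ∀ m ∈ Finset.univ, 0 ≤ w m * (1 - inner ℝ (v m) p) := fun m _ =>
      mul_nonneg (hw0 m) (by linarith [hle m])
    have h2 := (Finset.sum_eq_zero_iff_of_nonneg hnn).1 (h1.antisymm (Finset.sum_nonneg hnn))
    have h3 : ∀ m, m ≠ j ∧ m ≠ k → w m = 0 := fun m hm => by
      rcases mul_eq_zero.1 (h2 m (Finset.mem_univ m)) with h | h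
      · exact h
      · linarith [hlt m hm.1 hm.2]
    refine ⟨w j, w k, hw0 j, hw0 k, ?_, ?_⟩
    · rw [← hw1, Fintype.sum_eq_add j k hjk h3]
    · rw [Fintype.sum_eq_add j k hjk fun m hm => by rw [h3 m hm, zero_smul]]

end Polytope

/-! ### The polytope in coordinates adapted to two vertices -/

section PairCoordinates

variable {ι : Type*} (v : ι → E3) (a b : E3)

/-- The first coefficient of `v m` in the basis `(a, b, a × b)`. -/
noncomputable def coeffFst (m : ι) : ℝ := inner ℝ (v m) (dualFst a b)

/-- The second coefficient of `v m` in the basis `(a, b, a × b)`. -/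
noncomputable def coeffSnd (m : ι) : ℝ := inner ℝ (v m) (dualSnd a b)

/-- Multiplication by the third coefficient of `v m` in the basis `(a, b, a × b)`. -/
noncomputable def coeffTrd (m : ι) : ℝ →L[ℝ] ℝ :=
  ContinuousLinearMap.toSpanSingleton ℝ (inner ℝ (v m) (dualTrd a b))

/-- The linear forms defined by the `v m`, in the coordinates given by `a`, `b`, `a × b`. -/
noncomputable def pairForms : ι → ℝ × ℝ × ℝ →L[ℝ] ℝ :=
  coordExt (coeffFst v a b) (coordExt (coeffSnd v a b) (coeffTrd v a b))

variable {v a b}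

theorem coeffTrd_apply (m : ι) (r : ℝ) :
    coeffTrd v a b m r = inner ℝ (v m) (dualTrd a b) * r := by
  simp [coeffTrd, mul_comm]

theorem coeffTrd_eq_zero {m : ι} (h : coeffTrd v a b m = 0) : inner ℝ (v m) (dualTrd a b) = 0 := by
  simpa [coeffTrd_apply] using congrArg (fun f : ℝ →L[ℝ] ℝ => f 1) h

theorem pairForms_pairCoords (h : cross a b ≠ 0) (m : ι) (p : E3) :
    pairForms v a b m (pairCoords a b p) = inner ℝ (v m) p := by
  rw [inner_expansion h (v m) p]
  simp [pairForms, pairCoords, coeffFst, coeffSnd, coeffTrd_apply]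

theorem pairCoords_combination (h : cross a b ≠ 0) (s t r : ℝ) :
    pairCoords a b (s • dualFst a b + t • dualSnd a b + r • dualTrd a b) = (s, t, r) := by
  have h1 : inner ℝ (cross a b) (dualFst a b) = 0 := by
    rw [dualFst, inner_smul_right, inner_eq_sum]
    simp
    right
    ring
  have h2 : inner ℝ (cross a b) (dualSnd a b) = 0 := by
    rw [dualSnd, inner_smul_right, inner_eq_sum]
    simp
    right
    ring
  simp [pairCoords, inner_add_right, inner_smul_right, inner_left_dualFst h, inner_left_dualSnd,
    inner_left_dualTrd, inner_right_dualFst, inner_right_dualSnd h, inner_right_dualTrd, h1, h2,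
    inner_cross_dualTrd h]

theorem surjective_pairCoords (h : cross a b ≠ 0) : Function.Surjective (pairCoords a b) :=
  fun q => ⟨_, pairCoords_combination h q.1 q.2.1 q.2.2⟩

variable {j k : ι}

theorem coeffFst_left (hjk : cross (v j) (v k) ≠ 0) : coeffFst v (v j) (v k) j = 1 :=
  inner_left_dualFst hjk

theorem coeffSnd_right (hjk : cross (v j) (v k) ≠ 0) : coeffSnd v (v j) (v k) k = 1 :=
  inner_right_dualSnd hjk

theorem coeffFst_right : coeffFst v (v j) (v k) k = 0 := inner_right_dualFst

theorem coeffTrd_left : coeffTrd v (v j) (v k) j = 0 := by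
  ext
  simp [coeffTrd_apply, inner_left_dualTrd]

theorem coeffTrd_right : coeffTrd v (v j) (v k) k = 0 := by
  ext
  simp [coeffTrd_apply, inner_right_dualTrd]

theorem coordExt_left : coordExt (coeffSnd v (v j) (v k)) (coeffTrd v (v j) (v k)) j = 0 := by
  ext <;> simp [coeffTrd_left, coeffSnd, inner_left_dualSnd]

variable [Fintype ι]

theorem volume_parPolytope (h : cross a b ≠ 0) (x : ι → ℝ) :
    volume.real (parPolytope v x) =
      (‖cross a b‖ ^ 2)⁻¹ * polyVol volume (pairForms v a b) Finset.univ x := by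
  have h1 : parPolytope v x = pairCoords a b ⁻¹' halfspaces (pairForms v a b) Finset.univ x := by
    ext p
    simp [parPolytope, halfspaces, pairForms_pairCoords h]
  rw [h1, measureReal_def, ← Measure.map_apply (continuous_pairCoords a b).measurable
    (isClosed_halfspaces _ _ _).measurableSet, map_pairCoords h, Measure.smul_apply,
    smul_eq_mul, ENNReal.toReal_mul, ENNReal.toReal_ofReal (by positivity)]
  rfl

theorem recession_pairForms (h : cross a b ≠ 0)
    (hb : ∀ p : E3, (∀ m, inner ℝ (v m) p ≤ 0) → p = 0) (q : ℝ × ℝ × ℝ)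
    (hq : ∀ m ∈ Finset.univ, pairForms v a b m q ≤ 0) : q = 0 := by
  obtain ⟨p, rfl⟩ := surjective_pairCoords h q
  have : p = 0 := hb p fun m => by
    rw [← pairForms_pairCoords h]
    exact hq m (Finset.mem_univ m)
  simp [this, pairCoords]

end PairCoordinates

theorem eventually_forall_imp_ne {ι κ : Type*} {P : κ → Prop} (S : Finset κ) {f : κ → (ι → ℝ) → ℝ}
    (hf : ∀ m, Continuous (f m)) {x : ι → ℝ} (h : ∀ m ∈ S, P m → f m x ≠ 0) :
    ∀ᶠ y in 𝓝 x, ∀ m ∈ S, P m → f m y ≠ 0 := by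
  rw [S.eventually_all]
  intro m hm
  by_cases hP : P m
  · filter_upwards [(hf m).continuousAt.eventually_ne (h m hm hP)] with y hy _
    exact hy
  · exact Eventually.of_forall fun y h => absurd h hP

/-! ### First and mixed second derivatives of the volume -/

section Derivatives

variable {ι : Type*} [Fintype ι] [DecidableEq ι] (v : ι → E3)

/-- The area, suitably scaled, of the facet of `parPolytope v x` with normal vector `v j`, in
the coordinates given by `v j` and `v k`. -/
noncomputable def facetVol (j k : ι) (x : ι → ℝ) : ℝ :=
  (‖cross (v j) (v k)‖ ^ 2)⁻¹ * polyVol volume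
    (coordExt (coeffSnd v (v j) (v k)) (coeffTrd v (v j) (v k))) (Finset.univ.erase j)
    fun m => x m - x j * coeffFst v (v j) (v k) m

/-- The length, suitably scaled, of the edge of `parPolytope v x` orthogonal to `v j` and `v k`. -/
noncomputable def edgeVol (j k : ι) (x : ι → ℝ) : ℝ :=
  (‖cross (v j) (v k)‖ ^ 2)⁻¹ * polyVol volume (coeffTrd v (v j) (v k))
    ((Finset.univ.erase j).erase k)
    fun m => x m - x j * coeffFst v (v j) (v k) m - x k * coeffSnd v (v j) (v k) m

/-- The properties of the vertices of a polytope with the origin in its interior on which the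
differentiability of the volume of `parPolytope v` depends. -/
structure IsVertexConfiguration {ι : Type*} (v : ι → E3) : Prop where
  recession : ∀ p : E3, (∀ m, inner ℝ (v m) p ≤ 0) → p = 0
  lt_one : ∀ j m (c : ℝ), m ≠ j → v m = c • v j → c < 1
  add_ne_one : ∀ j k m (s t : ℝ), j ≠ k → m ≠ j → m ≠ k → v m = s • v j + t • v k → s + t ≠ 1

variable {v} {j k : ι}

theorem IsVertexConfiguration.recession_coordExt (hv : IsVertexConfiguration v)
    (hjk : cross (v j) (v k) ≠ 0) (q : ℝ × ℝ) (hq : ∀ m ∈ Finset.univ.erase j,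
      coordExt (coeffSnd v (v j) (v k)) (coeffTrd v (v j) (v k)) m q ≤ 0) : q = 0 :=
  recession_erase coordExt_left (recession_pairForms hjk hv.recession) q hq

theorem IsVertexConfiguration.recession_coeffTrd (hv : IsVertexConfiguration v)
    (hjk : cross (v j) (v k) ≠ 0) (r : ℝ) (hr : ∀ m ∈ (Finset.univ.erase j).erase k,
      coeffTrd v (v j) (v k) m r ≤ 0) : r = 0 :=
  recession_erase coeffTrd_right (hv.recession_coordExt hjk) r hr

/-- A vanishing third coefficient puts `v m` in the plane spanned by `v j` and `v k`, where the
noncollinearity condition `add_ne_one` applies. This is the nondegeneracy of the second slicing. -/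
theorem IsVertexConfiguration.ne_zero_of_coeffTrd_eq_zero (hv : IsVertexConfiguration v)
    (hjk : cross (v j) (v k) ≠ 0) (m : ι) (hm : m ∈ (Finset.univ.erase j).erase k)
    (h : coeffTrd v (v j) (v k) m = 0) :
    1 - coeffFst v (v j) (v k) m - coeffSnd v (v j) (v k) m ≠ 0 := by
  have hjk' : j ≠ k := by
    rintro rfl
    apply hjk
    apply E3.ext <;> simp <;> ring
  have h1 := primal_expansion hjk (v m)
  rw [coeffTrd_eq_zero h, zero_smul, add_zero] at h1
  have h2 := hv.add_ne_one j k m _ _ hjk' (Finset.ne_of_mem_erase (Finset.mem_of_mem_erase hm))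
    (Finset.ne_of_mem_erase hm) h1
  intro h3
  apply h2
  simp only [coeffFst, coeffSnd] at h3
  linarith

theorem eventually_hasLineDerivAt_volume (hv : IsVertexConfiguration v)
    (hjk : cross (v j) (v k) ≠ 0) : ∀ᶠ x in 𝓝 (fun _ : ι => (1 : ℝ)),
      HasLineDerivAt ℝ (fun x => volume.real (parPolytope v x)) (facetVol v j k x) x
        (Pi.single j 1) := by
  have h1 : ∀ᶠ x in 𝓝 (fun _ : ι => (1 : ℝ)), ∀ m ∈ Finset.univ.erase j,
      coordExt (coeffSnd v (v j) (v k)) (coeffTrd v (v j) (v k)) m = 0 →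
        x m - x j * coeffFst v (v j) (v k) m ≠ 0 := by
    refine eventually_forall_imp_ne (f := fun m x => x m - x j * coeffFst v (v j) (v k) m) _
      (fun m => by fun_prop) fun m hm h => ?_
    -- A zero form on the slice means `v m = c • v j`; then the right-hand side at `(1, …, 1)` is `1
    -- - c`, which is positive.
    have hs : coeffSnd v (v j) (v k) m = 0 := by
      simpa using congrArg (fun f : ℝ × ℝ →L[ℝ] ℝ => f (1, 0)) h
    have ht : inner ℝ (v m) (dualTrd (v j) (v k)) = 0 := by
      simpa [coeffTrd_apply] using congrArg (fun f : ℝ × ℝ →L[ℝ] ℝ => f (0, 1)) h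
    have h2 := primal_expansion hjk (v m)
    rw [coeffSnd] at hs
    rw [ht, hs, zero_smul, zero_smul, add_zero, add_zero] at h2
    have := hv.lt_one j m _ (Finset.ne_of_mem_erase hm) h2
    rw [coeffFst]
    linarith
  filter_upwards [h1] with x hx
  have h2 := hasLineDerivAt_polyVol_coordExt (volume : Measure (ℝ × ℝ)) (Finset.mem_univ j)
    (coeffFst_left hjk) coordExt_left (recession_pairForms hjk hv.recession) hx
  refine HasDerivAt.congr_of_eventuallyEq (h2.const_mul (‖cross (v j) (v k)‖ ^ 2)⁻¹)
    (Eventually.of_forall fun t => volume_parPolytope hjk _)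

theorem eventually_hasLineDerivAt_facetVol (hv : IsVertexConfiguration v)
    (hjk : cross (v j) (v k) ≠ 0) : ∀ᶠ x in 𝓝 (fun _ : ι => (1 : ℝ)),
      HasLineDerivAt ℝ (facetVol v j k) (edgeVol v j k x) x (Pi.single k 1) := by
  have hjk' : k ≠ j := by
    rintro rfl
    apply hjk
    apply E3.ext <;> simp <;> ring
  have h1 : ∀ᶠ x in 𝓝 (fun _ : ι => (1 : ℝ)), ∀ m ∈ (Finset.univ.erase j).erase k,
      coeffTrd v (v j) (v k) m = 0 → x m - x j * coeffFst v (v j) (v k) m -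
        x k * coeffSnd v (v j) (v k) m ≠ 0 := by
    refine eventually_forall_imp_ne (f := fun m x => x m - x j * coeffFst v (v j) (v k) m -
        x k * coeffSnd v (v j) (v k) m) _ (fun m => by fun_prop) fun m hm h => ?_
    simpa using hv.ne_zero_of_coeffTrd_eq_zero hjk m hm h
  filter_upwards [h1] with x hx
  have h2 := hasLineDerivAt_polyVol_coordExt (volume : Measure ℝ)
    (x := fun m => x m - x j * coeffFst v (v j) (v k) m)
    (Finset.mem_erase.2 ⟨hjk', Finset.mem_univ k⟩)
    (coeffSnd_right hjk) coeffTrd_right (hv.recession_coordExt hjk)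
    (by simpa only [coeffFst_right, mul_zero, sub_zero] using hx)
  simp only [coeffFst_right, mul_zero, sub_zero] at h2
  refine HasDerivAt.congr_of_eventuallyEq (h2.const_mul (‖cross (v j) (v k)‖ ^ 2)⁻¹)
    (Eventually.of_forall fun t => ?_)
  show facetVol v j k _ = _ * polyVol _ _ _ _
  rw [facetVol]
  congr 2
  ext m
  simp [hjk'.symm]
  ring

theorem continuousAt_edgeVol (hv : IsVertexConfiguration v) (hjk : cross (v j) (v k) ≠ 0) :
    ContinuousAt (edgeVol v j k) fun _ => 1 := by
  have h1 : Continuous fun (x : ι → ℝ) m => x m - x j * coeffFst v (v j) (v k) m -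
      x k * coeffSnd v (v j) (v k) m := by fun_prop
  refine ContinuousAt.const_mul ?_ _
  refine ContinuousAt.comp (g := polyVol volume _ _) ?_ h1.continuousAt
  refine continuousAt_polyVol volume (hv.recession_coeffTrd hjk) fun m hm h => ?_
  simpa using hv.ne_zero_of_coeffTrd_eq_zero hjk m hm h

/-- On the plane of the facet of `j`, the `m`-th inequality reads `0 ≤ x m - c * x j`. It stays
strict near `(1, …, 1)`, so the facet does not depend on `x m`. Here `k` only serves to choose
coordinates. -/
theorem eventually_hasLineDerivAt_facetVol_of_smul (hv : IsVertexConfiguration v)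
    (hjk : cross (v j) (v k) ≠ 0) {m : ι} (hmj : m ≠ j) {c : ℝ} (hm : v m = c • v j) :
    ∀ᶠ x in 𝓝 (fun _ : ι => (1 : ℝ)),
      HasLineDerivAt ℝ (facetVol v j k) 0 x (Pi.single m 1) := by
  have hc := hv.lt_one j m c hmj hm
  have h1 : Continuous fun x : ι → ℝ => x m - x j * c := by fun_prop
  have hα : coeffFst v (v j) (v k) m = c := by
    rw [coeffFst, hm, real_inner_smul_left, inner_left_dualFst hjk, mul_one]
  have hb (q : ℝ × ℝ) : coordExt (coeffSnd v (v j) (v k)) (coeffTrd v (v j) (v k)) m q = 0 := by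
    simp [coeffSnd, coeffTrd_apply, hm, real_inner_smul_left, inner_left_dualSnd,
      inner_left_dualTrd]
  filter_upwards [h1.continuousAt.eventually (lt_mem_nhds (a := 0) (by simpa using hc))] with x hx
  have h2 : Continuous fun t : ℝ => (x + t • Pi.single m (1 : ℝ) : ι → ℝ) m -
      (x + t • Pi.single m (1 : ℝ) : ι → ℝ) j * c := by fun_prop
  have h3 : ∀ᶠ t in 𝓝 (0 : ℝ), 0 < (x + t • Pi.single m (1 : ℝ) : ι → ℝ) m -
      (x + t • Pi.single m (1 : ℝ) : ι → ℝ) j * c :=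
    h2.continuousAt.eventually (lt_mem_nhds (a := 0) (by simpa using hx))
  refine (hasDerivAt_const (0 : ℝ) (facetVol v j k x)).congr_of_eventuallyEq ?_
  filter_upwards [h3] with t ht
  simp only [facetVol, polyVol]
  congr 2
  ext q
  refine forall₂_congr fun n _ => ?_
  rcases eq_or_ne n m with rfl | hn
  · rw [hb]
    beta_reduce
    rw [hα]
    exact iff_of_true ht.le hx.le
  · simp [hn, hmj.symm]

end Derivatives

/-! ### Edge volumes and dual edges -/

section DualEdges

variable {ι : Type*} {Q : Set E3} {v : ι → E3} {j k : ι}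

theorem isVertexConfiguration_of_polytope (hv : Function.Injective v)
    (hvQ : range v = Q.extremePoints ℝ) (hQ : Q = convexHull ℝ (range v))
    (h0 : (0 : E3) ∈ interior Q) : IsVertexConfiguration v where
  recession := eq_zero_of_forall_inner_le_zero hQ h0
  lt_one _ _ _ hm h := lt_one_of_vertex_eq_smul hv hvQ h0 hm h
  add_ne_one _ _ _ _ _ hjk hj hk h := add_ne_one_of_vertex_eq hv hvQ hjk hj hk h

theorem cross_ne_zero_of_adj (hv : Function.Injective v)
    (hvQ : range v = Q.extremePoints ℝ) (hQ : Q = convexHull ℝ (range v))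
    (h0 : (0 : E3) ∈ interior Q) (h : (skeleton Q v).Adj j k) : cross (v j) (v k) ≠ 0 := by
  intro hc
  obtain ⟨c, hc⟩ := exists_eq_smul_of_cross_eq_zero (vertex_ne_zero hvQ h0 j) hc
  obtain ⟨p, hj, hk, -⟩ := exists_of_adj hv hvQ hQ h0 h
  rw [hc, real_inner_smul_left, hj, mul_one] at hk
  exact h.1 (by rw [hc, hk, one_smul])

theorem mem_dualFace_segment (hQ : Q = convexHull ℝ (range v)) {p : E3} :
    p ∈ dualFace Q (segment ℝ (v j) (v k)) ↔
      (∀ m, inner ℝ (v m) p ≤ 1) ∧ inner ℝ (v j) p = 1 ∧ inner ℝ (v k) p = 1 := by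
  rw [dualFace, polarDual_convexHull_range hQ]
  exact and_congr Iff.rfl ⟨fun h => ⟨h _ (left_mem_segment ℝ _ _), h _ (right_mem_segment ℝ _ _)⟩,
    fun h q hq => inner_eq_of_mem_segment h.1 h.2 hq⟩

theorem diam_segment_E3 (w w' : E3) : Metric.diam (segment ℝ w w') = ‖w - w'‖ := by
  rw [← convexHull_pair, convexHull_diam, Metric.diam_pair, dist_eq_norm]

theorem inner_eq_of_coords (hjk : cross (v j) (v k) ≠ 0) {p : E3} (hj : inner ℝ (v j) p = 1)
    (hk : inner ℝ (v k) p = 1) (m : ι) : inner ℝ (v m) p = coeffFst v (v j) (v k) m +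
      (coeffSnd v (v j) (v k) m + coeffTrd v (v j) (v k) m (inner ℝ (cross (v j) (v k)) p)) := by
  rw [inner_expansion hjk (v m) p, hj, hk, coeffTrd_apply, mul_one, mul_one]
  rfl

variable [Fintype ι] [DecidableEq ι]

variable (v j k) in
/-- The parameters of the points of the dual edge on the line of all `p` with
`v j ⬝ p = v k ⬝ p = 1`. -/
def edgeParams : Set ℝ :=
  halfspaces (coeffTrd v (v j) (v k)) ((Finset.univ.erase j).erase k)
    fun m => 1 - 1 * coeffFst v (v j) (v k) m - 1 * coeffSnd v (v j) (v k) m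

theorem mem_edgeParams_iff {r : ℝ} : r ∈ edgeParams v j k ↔ ∀ m, m ≠ j → m ≠ k →
    coeffFst v (v j) (v k) m + (coeffSnd v (v j) (v k) m + coeffTrd v (v j) (v k) m r) ≤ 1 := by
  simp only [edgeParams, halfspaces, Finset.mem_erase, Finset.mem_univ, and_true, one_mul]
  exact ⟨fun h m hj hk => by linarith [h m ⟨hk, hj⟩],
    fun h m hm => by linarith [h m hm.2 hm.1]⟩

theorem dualFace_eq_image (hQ : Q = convexHull ℝ (range v)) (hjk : cross (v j) (v k) ≠ 0) :
    dualFace Q (segment ℝ (v j) (v k)) =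
      AffineMap.lineMap (dualFst (v j) (v k) + dualSnd (v j) (v k))
        (dualFst (v j) (v k) + dualSnd (v j) (v k) + dualTrd (v j) (v k)) '' edgeParams v j k := by
  ext p
  rw [mem_dualFace_segment hQ]
  constructor
  · rintro ⟨h, hj, hk⟩
    refine ⟨inner ℝ (cross (v j) (v k)) p, mem_edgeParams_iff.2 fun m _ _ => ?_, ?_⟩
    · rw [← inner_eq_of_coords hjk hj hk]
      exact h m
    · conv_rhs => rw [dual_expansion hjk p, hj, hk]
      simp [AffineMap.lineMap_apply]
      abel
  · rintro ⟨r, hr, rfl⟩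
    have hp : AffineMap.lineMap (dualFst (v j) (v k) + dualSnd (v j) (v k))
        (dualFst (v j) (v k) + dualSnd (v j) (v k) + dualTrd (v j) (v k)) r =
        (1 : ℝ) • dualFst (v j) (v k) + (1 : ℝ) • dualSnd (v j) (v k) +
          r • dualTrd (v j) (v k) := by
      simp [AffineMap.lineMap_apply]
      abel
    have h1 := pairCoords_combination hjk 1 1 r
    rw [← hp] at h1
    set p := AffineMap.lineMap (dualFst (v j) (v k) + dualSnd (v j) (v k))
        (dualFst (v j) (v k) + dualSnd (v j) (v k) + dualTrd (v j) (v k)) r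
    simp only [pairCoords, Prod.mk.injEq] at h1
    refine ⟨fun m => ?_, h1.1, h1.2.1⟩
    by_cases hmj : m = j
    · rw [hmj, h1.1]
    by_cases hmk : m = k
    · rw [hmk, h1.2.1]
    rw [inner_eq_of_coords hjk h1.1 h1.2.1, h1.2.2]
    exact mem_edgeParams_iff.1 hr m hmj hmk

theorem edgeParams_eq_empty_or_Icc (hv : IsVertexConfiguration v)
    (hjk : cross (v j) (v k) ≠ 0) :
    edgeParams v j k = ∅ ∨ ∃ s t, s ≤ t ∧ edgeParams v j k = Icc s t := by
  rcases (edgeParams v j k).eq_empty_or_nonempty with h | h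
  · exact Or.inl h
  right
  obtain ⟨C, hC⟩ := exists_halfspaces_subset_closedBall (hv.recession_coeffTrd hjk)
  have hcomp : IsCompact (edgeParams v j k) :=
    (isCompact_closedBall _ _).of_isClosed_subset (isClosed_halfspaces _ _ _) (hC _)
  have hconv : Convex ℝ (edgeParams v j k) := by
    simp only [edgeParams, halfspaces, ofPred_forall]
    exact convex_iInter₂ fun m _ => convex_halfSpace_le (coeffTrd v (v j) (v k) m).isLinear _
  have h1 := eq_Icc_of_connected_compact ⟨h, hconv.isPreconnected⟩ hcomp
  exact ⟨_, _, nonempty_Icc.1 (h1 ▸ h), h1⟩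

theorem edgeVol_one : edgeVol v j k (fun _ => 1) =
    (‖cross (v j) (v k)‖ ^ 2)⁻¹ * volume.real (edgeParams v j k) := rfl

/-- A unit of the parameter `(v j × v k) ⬝ p` moves the point by `dualTrd`, of length `1 / ‖v j × v
k‖`, which leaves one such factor from `edgeVol`. Taking the endpoint with the smaller parameter as
`w` gives the negative sign. -/
theorem edgeVol_eq_diam (hv : IsVertexConfiguration v) (hQ : Q = convexHull ℝ (range v))
    (hjk : cross (v j) (v k) ≠ 0) :
    edgeVol v j k (fun _ => 1) =
      Metric.diam (dualFace Q (segment ℝ (v j) (v k))) / ‖cross (v j) (v k)‖ ∧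
    (0 < edgeVol v j k (fun _ => 1) → ∃ w w', w ≠ w' ∧
      dualFace Q (segment ℝ (v j) (v k)) = segment ℝ w w' ∧
      w - w' = -edgeVol v j k (fun _ => 1) • cross (v j) (v k)) := by
  have hn : ‖cross (v j) (v k)‖ ≠ 0 := by simpa using hjk
  rw [edgeVol_one, dualFace_eq_image hQ hjk]
  rcases edgeParams_eq_empty_or_Icc hv hjk with h | ⟨s, t, hst, h⟩
  · simp [h]
  · rw [h, ← segment_eq_Icc hst, image_segment, diam_segment_E3, segment_eq_Icc hst,
      Real.volume_real_Icc_of_le hst]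
    have hsub : (AffineMap.lineMap (dualFst (v j) (v k) + dualSnd (v j) (v k))
        (dualFst (v j) (v k) + dualSnd (v j) (v k) + dualTrd (v j) (v k)) s : E3) -
        AffineMap.lineMap (dualFst (v j) (v k) + dualSnd (v j) (v k))
        (dualFst (v j) (v k) + dualSnd (v j) (v k) + dualTrd (v j) (v k)) t =
        -((‖cross (v j) (v k)‖ ^ 2)⁻¹ * (t - s)) • cross (v j) (v k) := by
      simp only [AffineMap.lineMap_apply, vsub_eq_sub, add_sub_cancel_left, vadd_eq_add,
        add_sub_add_right_eq_sub, dualTrd]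
      rw [← sub_smul, smul_smul]
      congr 1
      ring
    rw [hsub]
    refine ⟨?_, fun hpos => ⟨_, _, ?_, rfl, hsub⟩⟩
    · rw [neg_smul, norm_neg, norm_smul, Real.norm_of_nonneg
        (mul_nonneg (by positivity) (by linarith))]
      field_simp
    · rw [← sub_ne_zero, hsub]
      exact smul_ne_zero (neg_ne_zero.2 hpos.ne') hjk

theorem edgeVol_pos_iff (hvi : Function.Injective v)
    (hvQ : range v = Q.extremePoints ℝ) (hQ : Q = convexHull ℝ (range v))
    (h0 : (0 : E3) ∈ interior Q) (hjk : cross (v j) (v k) ≠ 0) :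
    0 < edgeVol v j k (fun _ => 1) ↔ (skeleton Q v).Adj j k := by
  have hv := isVertexConfiguration_of_polytope hvi hvQ hQ h0
  have hN : 0 < (‖cross (v j) (v k)‖ ^ 2)⁻¹ := by
    have : ‖cross (v j) (v k)‖ ≠ 0 := by simpa using hjk
    positivity
  have hjk' : j ≠ k := by
    rintro rfl
    apply hjk
    apply E3.ext <;> simp <;> ring
  rw [edgeVol_one, mul_pos_iff_of_pos_left hN]
  constructor
  · intro hpos
    rcases edgeParams_eq_empty_or_Icc hv hjk with h | ⟨s, t, hst, h⟩
    · simp [h] at hpos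
    rw [h, Real.volume_real_Icc_of_le hst] at hpos
    have hs := mem_edgeParams_iff.1 (h ▸ left_mem_Icc.2 hst)
    have ht := mem_edgeParams_iff.1 (h ▸ right_mem_Icc.2 hst)
    have h1 := pairCoords_combination hjk 1 1 ((s + t) / 2)
    set p := (1 : ℝ) • dualFst (v j) (v k) + (1 : ℝ) • dualSnd (v j) (v k) +
      ((s + t) / 2) • dualTrd (v j) (v k)
    simp only [pairCoords, Prod.mk.injEq] at h1
    refine adj_of_inner_lt hvi hvQ hQ hjk' h1.1 h1.2.1 fun m hmj hmk => ?_
    rw [inner_eq_of_coords hjk h1.1 h1.2.1, h1.2.2]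
    have hs := hs m hmj hmk
    have ht := ht m hmj hmk
    have hne := hv.ne_zero_of_coeffTrd_eq_zero hjk m (by simp [hmj, hmk])
    rw [coeffTrd_apply] at *
    set γ : ℝ := inner ℝ (v m) (dualTrd (v j) (v k))
    have hle : coeffFst v (v j) (v k) m + (coeffSnd v (v j) (v k) m + γ * ((s + t) / 2)) ≤ 1 := by
      linarith
    -- Equality at the midpoint of an interval on which the affine constraint holds makes the
    -- constraint constant, so `γ = 0`, and nondegeneracy excludes equality.
    refine hle.lt_of_ne fun he => ?_
    have hγ : γ * (t - s) = 0 := by linarith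
    have hγ : γ = 0 := (mul_eq_zero.1 hγ).resolve_right hpos.ne'
    refine hne ?_ ?_
    · ext
      simp only [coeffTrd_apply, zero_apply]
      exact mul_eq_zero_of_left hγ _
    · rw [hγ] at he
      linarith
  · intro hadj
    obtain ⟨p, hj, hk, hlt⟩ := exists_of_adj hvi hvQ hQ h0 hadj
    set r : ℝ := inner ℝ (cross (v j) (v k)) p
    -- The exposing point satisfies all other inequalities strictly, so its parameter is interior
    -- and the interval has positive length.
    have hmem : edgeParams v j k ∈ 𝓝 r := by
      have h1 : ∀ᶠ r' in 𝓝 r, ∀ m, m ≠ j → m ≠ k → coeffFst v (v j) (v k) m +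
          (coeffSnd v (v j) (v k) m + coeffTrd v (v j) (v k) m r') < 1 := by
        refine eventually_all.2 fun m => ?_
        by_cases hmj : m = j
        · simp [hmj]
        by_cases hmk : m = k
        · simp [hmk]
        have hc : Continuous fun r' => coeffFst v (v j) (v k) m +
          (coeffSnd v (v j) (v k) m + coeffTrd v (v j) (v k) m r') := by fun_prop
        have h2 := hlt m hmj hmk
        rw [inner_eq_of_coords hjk hj hk] at h2
        filter_upwards [hc.continuousAt.eventually (gt_mem_nhds h2)] with r' hr' _ _ using hr'
      filter_upwards [h1] with r' hr'
      exact mem_edgeParams_iff.2 fun m hmj hmk => (hr' m hmj hmk).le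
    rcases edgeParams_eq_empty_or_Icc hv hjk with h | ⟨s, t, hst, h⟩
    · simp [h] at hmem
    · rw [h] at hmem
      have := Icc_mem_nhds_iff.1 hmem
      rw [h, Real.volume_real_Icc_of_le hst]
      linarith [this.1, this.2]

end DualEdges

/-! ### Translation invariance, the Hessian and the Lovász matrix -/

section Hessian

variable {ι : Type*} {Q : Set E3} {v : ι → E3}

theorem parPolytope_add_inner (x : ι → ℝ) (q : E3) :
    parPolytope v (fun m => x m + inner ℝ (v m) q) = (fun p => -q + p) ⁻¹' parPolytope v x := by
  ext p
  simp only [parPolytope, mem_ofPred_eq, mem_preimage, inner_add_right, inner_neg_right]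
  exact forall_congr' fun m => ⟨fun h => by linarith, fun h => by linarith⟩

theorem volume_parPolytope_add_inner (x : ι → ℝ) (q : E3) :
    volume.real (parPolytope v (fun m => x m + inner ℝ (v m) q)) =
      volume.real (parPolytope v x) := by
  rw [parPolytope_add_inner, measureReal_def, measure_preimage_add, measureReal_def]

variable (Q v) in
/-- The length of the dual edge of `v j v k`, divided by the length of `v j × v k`. -/
noncomputable def dualEdgeRatio (j k : ι) : ℝ :=
  Metric.diam (dualFace Q (segment ℝ (v j) (v k))) / ‖cross (v j) (v k)‖

theorem dualEdgeRatio_comm (j k : ι) : dualEdgeRatio Q v j k = dualEdgeRatio Q v k j := by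
  rw [dualEdgeRatio, dualEdgeRatio, segment_symm, cross_swap, norm_neg]

/-- A polytope with the origin in its interior, and a labelling of its vertices. -/
structure IsVertexLabelling (Q : Set E3) (v : ι → E3) : Prop where
  injective : Function.Injective v
  range_eq : range v = Q.extremePoints ℝ
  eq_convexHull : Q = convexHull ℝ (range v)
  zero_mem : (0 : E3) ∈ interior Q

namespace IsVertexLabelling

theorem isVertexConfiguration (h : IsVertexLabelling Q v) : IsVertexConfiguration v :=
  isVertexConfiguration_of_polytope h.injective h.range_eq h.eq_convexHull h.zero_mem

theorem exists_cross_ne_zero (h : IsVertexLabelling Q v) (j : ι) :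
    ∃ k, cross (v j) (v k) ≠ 0 :=
  _root_.exists_cross_ne_zero h.range_eq h.eq_convexHull h.zero_mem j

end IsVertexLabelling

variable [Fintype ι] [DecidableEq ι]

variable (v) in
/-- The partial derivative of the volume of `parPolytope v` with respect to the `j`-th
coordinate. -/
noncomputable def volPartial (j : ι) (x : ι → ℝ) : ℝ :=
  lineDeriv ℝ (fun x => volume.real (parPolytope v x)) x (Pi.single j (1 : ℝ))

theorem volPartial_add_inner (j : ι) (x : ι → ℝ) (q : E3) :
    volPartial v j (fun m => x m + inner ℝ (v m) q) = volPartial v j x := by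
  simp only [volPartial, lineDeriv]
  congr 1
  ext t
  rw [← volume_parPolytope_add_inner (x + _) q]
  congr 2
  ext m
  simp only [Pi.add_apply]
  ring

namespace IsVertexLabelling

theorem eventually_lineDifferentiableAt (h : IsVertexLabelling Q v) (j : ι) :
    ∀ᶠ x in 𝓝 (fun _ : ι => (1 : ℝ)), LineDifferentiableAt ℝ
      (fun x => volume.real (parPolytope v x)) x (Pi.single j (1 : ℝ)) := by
  obtain ⟨k, hk⟩ := h.exists_cross_ne_zero j
  filter_upwards [eventually_hasLineDerivAt_volume h.isVertexConfiguration hk] with x hx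
  exact hx.lineDifferentiableAt

theorem volPartial_eventuallyEq (h : IsVertexLabelling Q v) {j k : ι}
    (hjk : cross (v j) (v k) ≠ 0) :
    volPartial v j =ᶠ[𝓝 fun _ => 1] facetVol v j k := by
  filter_upwards [eventually_hasLineDerivAt_volume h.isVertexConfiguration hjk] with x hx
  exact hx.lineDeriv

theorem exists_partial (h : IsVertexLabelling Q v) {j k : ι} (hkj : k ≠ j) :
    ∃ B : (ι → ℝ) → ℝ, (∀ᶠ x in 𝓝 (fun _ : ι => (1 : ℝ)),
      HasLineDerivAt ℝ (volPartial v j) (B x) x (Pi.single k 1)) ∧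
      ContinuousAt B (fun _ => 1) ∧ B (fun _ => 1) = dualEdgeRatio Q v j k := by
  have hv := h.isVertexConfiguration
  by_cases hjk : cross (v j) (v k) = 0
  · obtain ⟨k', hk'⟩ := h.exists_cross_ne_zero j
    obtain ⟨c, hc⟩ := exists_eq_smul_of_cross_eq_zero (vertex_ne_zero h.range_eq h.zero_mem j) hjk
    -- For parallel vertices, `dualEdgeRatio` is zero because division by zero gives zero, in
    -- agreement with the vanishing derivative.
    refine ⟨fun _ => 0, ?_, continuousAt_const, by simp [dualEdgeRatio, hjk]⟩
    filter_upwards [eventually_hasLineDerivAt_facetVol_of_smul hv hk' hkj hc,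
      (h.volPartial_eventuallyEq hk').eventuallyEq_nhds] with x hx hx'
    exact hx.congr_of_eventuallyEq hx'
  · refine ⟨edgeVol v j k, ?_, continuousAt_edgeVol hv hjk,
      (edgeVol_eq_diam hv h.eq_convexHull hjk).1⟩
    filter_upwards [eventually_hasLineDerivAt_facetVol hv hjk,
      (h.volPartial_eventuallyEq hjk).eventuallyEq_nhds] with x hx hx'
    exact hx.congr_of_eventuallyEq hx'

theorem hasLineDerivAt_volPartial (h : IsVertexLabelling Q v) {j : ι} {d : ι → ℝ} (hd : d j = 0) :
    HasLineDerivAt ℝ (volPartial v j)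
      (∑ k ∈ Finset.univ.erase j, d k * dualEdgeRatio Q v j k) (fun _ => 1) d := by
  have : ∀ k, ∃ B : (ι → ℝ) → ℝ, k ≠ j → (∀ᶠ x in 𝓝 (fun _ : ι => (1 : ℝ)),
      HasLineDerivAt ℝ (volPartial v j) (B x) x (Pi.single k 1)) ∧
      ContinuousAt B (fun _ => 1) ∧ B (fun _ => 1) = dualEdgeRatio Q v j k := fun k => by
    by_cases hk : k = j
    · exact ⟨0, fun h => absurd hk h⟩
    · obtain ⟨B, hB⟩ := h.exists_partial hk
      exact ⟨B, fun _ => hB⟩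
  choose B hB using this
  have h1 := hasLineDerivAt_sum_of_continuousAt (e := fun k => (Pi.single k 1 : ι → ℝ))
    (Finset.univ.erase j) d (fun k hk => (hB k (Finset.ne_of_mem_erase hk)).1)
    (fun k hk => (hB k (Finset.ne_of_mem_erase hk)).2.1)
  have hsum : ∑ k ∈ Finset.univ.erase j, d k * B k (fun _ => 1) =
      ∑ k ∈ Finset.univ.erase j, d k * dualEdgeRatio Q v j k :=
    Finset.sum_congr rfl fun k hk => by rw [(hB k (Finset.ne_of_mem_erase hk)).2.2]
  have hdir : ∑ k ∈ Finset.univ.erase j, d k • (Pi.single k 1 : ι → ℝ) = d := by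
    ext m
    rw [Finset.sum_apply]
    simp only [Pi.smul_apply, Pi.single_apply, smul_eq_mul, mul_ite, mul_one, mul_zero]
    rw [Finset.sum_ite_eq]
    by_cases hm : m = j <;> simp [hm, hd]
  rw [hsum, hdir] at h1
  exact h1

/-- Both sides compute the derivative of `volPartial v j` along the translation direction of `q`;
the condition on `q` makes its `j`-th coordinate zero. -/
theorem sum_dualEdgeRatio_mul_inner (h : IsVertexLabelling Q v) {j : ι} {q : E3}
    (hq : inner ℝ (v j) q = 0) :
    ∑ k ∈ Finset.univ.erase j, inner ℝ (v k) q * dualEdgeRatio Q v j k = 0 := by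
  have h1 := h.hasLineDerivAt_volPartial (d := fun k => inner ℝ (v k) q) hq
  refine HasDerivAt.unique h1 ((hasDerivAt_const (0 : ℝ) (volPartial v j fun _ => 1)
    ).congr_of_eventuallyEq (Eventually.of_forall fun t => ?_))
  show volPartial v j _ = _
  rw [← volPartial_add_inner j (fun _ => 1) (t • q)]
  congr 1
  ext m
  simp [inner_smul_right]

end IsVertexLabelling

variable (Q v) in
/-- The matrix of second partial derivatives of the volume of `parPolytope v` at `(1, …, 1)`. -/
noncomputable def volHessian : Matrix ι ι ℝ := fun i j =>
  if i = j then -∑ k ∈ Finset.univ.erase i,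
    inner ℝ (v k) ((‖v i‖ ^ 2)⁻¹ • v i) * dualEdgeRatio Q v i k
  else dualEdgeRatio Q v i j

namespace IsVertexLabelling

theorem hasHessianMatrixAt (h : IsVertexLabelling Q v) :
    HasHessianMatrixAt (fun x : ι → ℝ => volume.real (parPolytope v x)) (volHessian Q v)
      (fun _ => 1) := by
  refine ⟨h.eventually_lineDifferentiableAt, fun i j => ?_⟩
  change HasLineDerivAt ℝ (volPartial v j) _ _ _
  by_cases hij : i = j
  · subst hij
    set u := (‖v i‖ ^ 2)⁻¹ • v i
    have hu : inner ℝ (v i) u = 1 := by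
      have := vertex_ne_zero h.range_eq h.zero_mem i
      rw [inner_smul_right, real_inner_self_eq_norm_sq, inv_mul_cancel₀ (by simpa using this)]
    -- Subtracting the translation direction of `u` from `e i` leaves the values of `volPartial v i`
    -- unchanged and makes the `i`-th coordinate zero, so only mixed partials contribute.
    have h1 := h.hasLineDerivAt_volPartial (j := i)
      (d := fun k => Pi.single (M := fun _ => ℝ) i 1 k - inner ℝ (v k) u) (by simp [hu])
    have h2 : volHessian Q v i i = ∑ k ∈ Finset.univ.erase i,
        (Pi.single (M := fun _ => ℝ) i 1 k - inner ℝ (v k) u) * dualEdgeRatio Q v i k := by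
      rw [volHessian, if_pos rfl, ← Finset.sum_neg_distrib]
      refine Finset.sum_congr rfl fun k hk => ?_
      rw [Pi.single_eq_of_ne (Finset.ne_of_mem_erase hk)]
      ring
    rw [h2]
    refine HasDerivAt.congr_of_eventuallyEq h1 (Eventually.of_forall fun t => ?_)
    show volPartial v i _ = volPartial v i _
    rw [← volPartial_add_inner i _ (-(t • u))]
    congr 1
    ext m
    simp [inner_smul_right]
    ring
  · obtain ⟨B, hB, -, hB1⟩ := h.exists_partial (j := j) (k := i) hij
    rw [volHessian, if_neg hij, dualEdgeRatio_comm, ← hB1]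
    exact hB.self_of_nhds

/-- Tested against `q`: the part of `q` orthogonal to `v i` contributes nothing by translation
invariance, and the part along `u` reproduces the definition of the diagonal entry. -/
theorem sum_smul_eq (h : IsVertexLabelling Q v) (i : ι) :
    ∑ k ∈ Finset.univ.erase i, dualEdgeRatio Q v i k • v k = -volHessian Q v i i • v i := by
  have hN : ‖v i‖ ^ 2 ≠ 0 := by simpa using vertex_ne_zero h.range_eq h.zero_mem i
  set u := (‖v i‖ ^ 2)⁻¹ • v i with hu
  have hiu : inner ℝ (v i) u = 1 := by
    rw [inner_smul_right, real_inner_self_eq_norm_sq, inv_mul_cancel₀ hN]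
  have hinner : ∀ q, inner ℝ (∑ k ∈ Finset.univ.erase i, dualEdgeRatio Q v i k • v k) q =
      ∑ k ∈ Finset.univ.erase i, inner ℝ (v k) q * dualEdgeRatio Q v i k := fun q => by
    rw [sum_inner]
    exact Finset.sum_congr rfl fun k _ => by rw [real_inner_smul_left, mul_comm]
  refine ext_inner_right ℝ fun q => ?_
  have h1 := h.sum_dualEdgeRatio_mul_inner (j := i) (q := q - inner ℝ (v i) q • u)
    (by rw [inner_sub_right, inner_smul_right, hiu, mul_one, sub_self])
  rw [← hinner, inner_sub_right, inner_smul_right, hinner u, sub_eq_zero] at h1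
  rw [h1, volHessian, if_pos rfl, neg_neg, real_inner_smul_left, mul_comm]

theorem dualEdgeRatio_of_adj (h : IsVertexLabelling Q v) {i j : ι} (hij : (skeleton Q v).Adj i j) :
    0 < dualEdgeRatio Q v i j ∧ ∃ w w', w ≠ w' ∧
      dualFace Q (segment ℝ (v i) (v j)) = segment ℝ w w' ∧
      w - w' = -dualEdgeRatio Q v i j • cross (v i) (v j) := by
  have hc := cross_ne_zero_of_adj h.injective h.range_eq h.eq_convexHull h.zero_mem hij
  have h1 := edgeVol_eq_diam h.isVertexConfiguration h.eq_convexHull hc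
  have h2 := (edgeVol_pos_iff h.injective h.range_eq h.eq_convexHull h.zero_mem hc).2 hij
  rw [dualEdgeRatio, ← h1.1]
  exact ⟨h2, h1.2 h2⟩

theorem dualEdgeRatio_of_not_adj (h : IsVertexLabelling Q v) {i j : ι}
    (hij : ¬ (skeleton Q v).Adj i j) : dualEdgeRatio Q v i j = 0 := by
  by_cases hc : cross (v i) (v j) = 0
  · simp [dualEdgeRatio, hc]
  · have h1 := edgeVol_eq_diam h.isVertexConfiguration h.eq_convexHull hc
    have h2 := (edgeVol_pos_iff h.injective h.range_eq h.eq_convexHull h.zero_mem hc).not.2 hij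
    rw [h1.1, ← dualEdgeRatio] at h2
    refine le_antisymm (not_lt.1 h2) ?_
    unfold dualEdgeRatio
    positivity

open Classical in
theorem sum_adj_eq {M : Matrix ι ι ℝ}
    (hM : ∀ i j, i ≠ j → ¬ (skeleton Q v).Adj i j → M i j = 0) (i : ι) :
    ∑ j with (skeleton Q v).Adj i j, M i j • v j = ∑ j ∈ Finset.univ.erase i, M i j • v j := by
  rw [Finset.sum_filter]
  refine (Finset.sum_subset_zero_on_sdiff (Finset.erase_subset i _) ?_ ?_).symm
  · intro j hj
    have : j = i := by simpa using hj
    simp [this]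
  · intro j hj
    split_ifs with hadj
    · rfl
    · rw [hM i j (Finset.ne_of_mem_erase hj).symm hadj, zero_smul]

theorem isLovaszMatrix (h : IsVertexLabelling Q v) : IsLovaszMatrix Q v (-volHessian Q v) := by
  have hoff : ∀ i j, i ≠ j → (-volHessian Q v) i j = -dualEdgeRatio Q v i j := fun i j hij => by
    rw [Matrix.neg_apply, volHessian, if_neg hij]
  have hnon : ∀ i j, i ≠ j → ¬ (skeleton Q v).Adj i j → (-volHessian Q v) i j = 0 :=
    fun i j hij hadj => by rw [hoff i j hij, h.dualEdgeRatio_of_not_adj hadj, neg_zero]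
  refine ⟨fun i j hij => ?_, hnon, fun i => ?_⟩
  · rw [hoff i j hij.ne]
    have := h.dualEdgeRatio_of_adj hij
    exact ⟨neg_neg_of_pos this.1, this.2⟩
  · rw [sum_adj_eq hnon, Matrix.neg_apply, neg_neg, ← neg_inj, ← neg_smul, ← h.sum_smul_eq,
      ← Finset.sum_neg_distrib]
    exact Finset.sum_congr rfl fun j hj => by
      rw [hoff i j (Finset.ne_of_mem_erase hj).symm, neg_smul, neg_neg]

/-- The length of the dual edge fixes `|M i j|`, the sign condition fixes `M i j`, and the diagonal
then follows from `v i ≠ 0`. -/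
theorem eq_of_isLovaszMatrix (h : IsVertexLabelling Q v) {M : Matrix ι ι ℝ}
    (hM : IsLovaszMatrix Q v M) : M = -volHessian Q v := by
  have hoff : ∀ i j, i ≠ j → M i j = (-volHessian Q v) i j := by
    intro i j hij
    by_cases hadj : (skeleton Q v).Adj i j
    · obtain ⟨hneg, w, w', -, hseg, hw⟩ := hM.edge i j hadj
      have hc := cross_ne_zero_of_adj h.injective h.range_eq h.eq_convexHull h.zero_mem hadj
      have hn : ‖cross (v i) (v j)‖ ≠ 0 := by simpa using hc
      rw [Matrix.neg_apply, volHessian, if_neg hij, dualEdgeRatio, hseg, diam_segment_E3, hw,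
        norm_smul, Real.norm_of_nonpos hneg.le, mul_div_cancel_right₀ _ hn, neg_neg]
    · rw [hM.nonadj i j hij hadj, h.isLovaszMatrix.nonadj i j hij hadj]
  ext i j
  by_cases hij : i = j
  · subst hij
    have h1 := hM.diag i
    have h2 := h.isLovaszMatrix.diag i
    rw [sum_adj_eq hM.nonadj, Finset.sum_congr rfl fun j hj => by
      rw [hoff i j (Finset.ne_of_mem_erase hj).symm],
      ← sum_adj_eq h.isLovaszMatrix.nonadj, h2] at h1
    have h3 := smul_left_injective ℝ (vertex_ne_zero h.range_eq h.zero_mem i) h1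
    exact (neg_injective h3).symm
  · exact hoff i j hij

end IsVertexLabelling

end Hessian

theorem mainTheorem4 {ι : Type*} [Fintype ι] [DecidableEq ι] (Q : Set E3)
    (hQ : IsConvexPolytope Q) (h0 : (0 : E3) ∈ interior Q)
    (v : ι → E3) (hv : Function.Injective v) (hvQ : Set.range v = Q.extremePoints ℝ) :
    parPolytope v (fun _ => 1) = polarDual Q ∧
    (∃! M : Matrix ι ι ℝ, IsLovaszMatrix Q v M) ∧
    ∀ M : Matrix ι ι ℝ, IsLovaszMatrix Q v M →
      HasHessianMatrixAt (fun x : ι → ℝ => volume.real (parPolytope v x)) (-M) (fun _ => 1) := by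
  have h : IsVertexLabelling Q v := ⟨hv, hvQ, hQ.eq_convexHull_range hvQ, h0⟩
  refine ⟨(polarDual_convexHull_range h.eq_convexHull).symm,
    ⟨_, h.isLovaszMatrix, fun M hM => h.eq_of_isLovaszMatrix hM⟩, fun M hM => ?_⟩
  rw [h.eq_of_isLovaszMatrix hM, neg_neg]
  exact h.hasHessianMatrixAt
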